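/- **Expander walks are two-step tensorial.** There exist universal constants $c' > 0$ and $C' > 0$ such that the following holds. *Graphs and walks.* Let $G$ be a finite nonempty undirected graph on a vertex set $V$ with nonnegative symmetric edge weights (self-loops allowed, no isolated vertices). For $k \ge 1$ let $W_G(k)$ be the collection of walks $w=(w_1,\dots,w_k)$ with $k$ vertices in $G$, with the distribution $\Pi_k$ in which $w_1$ is drawn from the stationary distribution of the random walk on $G$ (proportional to the weighted degree) and $w_2,\dots,w_k$ are obtained by $k-1$ steps of this random walk. If $1=\lambda_1\ge\lambda_2\ge\dots\ge\lambda_n$ are the eigenvalues of the normalized random walk operator of $G$, then $G$ is a $\gamma$-two-sided expander if $|\lambda_i|\le\gamma$ for all $i\ge 2$. *Ensembles.* A $t$-local PSD ensemble $\mathbf Z=\{\mathbf Z_v\}_{v\in V}$ over a finite alphabet $\Sigma$ consists of probability distributions $\{\mathbf Z_S\}$ on $\Sigma^S$ for all $S\subseteq V$ with $|S|\le t$, consistent under restriction to subsets, such that for every $T \subseteq V$ with $|T|\le t-2$ and every $\xi\in\Sigma^T$ with $\Pr[\mathbf Z_T=\xi]>0$ the conditional covariance matrix of the indicators $\mathbf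 1[\mathbf Z_S=\alpha]$, $|S|\le (t-|T|)/2$, $\alpha\in\Sigma^S$, given $\mathbf Z_T=\xi$, is positive semidefinite. For a tuple $w$ of vertices, $\{\mathbf Z_w\}$ is the joint distribution of $(\mathbf Z_{w_1},\dots,\mathbf Z_{w_k})$ on $\Sigma^k$. *Propagation rounding.* Given $L\ge k$ and an $(L+2k)$-local PSD ensemble $\mathbf Z$: choose $m\in\{1,\dots,\lfloor L/k\rfloor\}$ uniformly, sample $m$ independent walks from $\Pi_k$, let $S$ be the set of all their vertices, sample $\sigma\sim\{\mathbf Z_S\}$, and let $\mathbf Z'$ be $\mathbf Z$ conditioned on $\mathbf Z_S=\sigma$. Write $\mathbb E_\Omega$ for the expectation over $(m,S,\sigma)$. *Claim.* Let $k,q,L\in\mathbb N$ with $k\ge1$, let $\mu\in(0,1]$, and suppose that $$L\ \ge\ c'\cdot\frac{q^{4k}\,k^7}{\mu^5}$$ and that $G$ is a $\gamma$-two-sided expander with $$\gamma\ \le\ C'\cdot\frac{\mu^2}{k^2\,q^{2k}}.$$ Then $W_G(k)$ is $(\mu,L)$-two-step tensorial: for every $(L+2k)$-local PSD ensemble $\mathbf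 Z$ on $V$ with $|\mathrm{supp}(\mathbf Z_v)|\le q$ for all $v\in V$, we have $L\ge k$, $$\mathbb E_\Omega\ \mathbb E_{w\sim\Pi_k}\bigl\|\{\mathbf Z'_w\}-\{\mathbf Z'_{w_1}\}\cdots\{\mathbf Z'_{w_k}\}\bigr\|_1\le\mu,$$ and $$\mathbb E_\Omega\ \mathbb E_{s,t\sim\Pi_k}\bigl\|\{\mathbf Z'_s\mathbf Z'_t\}-\{\mathbf Z'_s\}\{\mathbf Z'_t\}\bigr\|_1\le\mu,$$ where $s,t$ are independent and $\|\cdot\|_1$ is the $\ell_1$ norm (sum of absolute values). -/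

import Mathlib

/-! ### Weighted graphs, walk distributions, two-sided expansion -/

/-- A finite undirected graph with nonnegative edge weights (a pair of weight `0` is a non-edge,
self-loops are allowed) and no isolated vertex. An unweighted graph has weights `0` and `1`;
multigraphs are covered by integer weights. -/
structure WeightedGraph (V : Type) [Fintype V] where
  weight : V → V → ℝ
  weight_symm : ∀ u v, weight u v = weight v u
  weight_nonneg : ∀ u v, 0 ≤ weight u v
  exists_weight_pos : ∀ u, ∃ v, 0 < weight u v

namespace WeightedGraph

variable {V : Type} [Fintype V] (G : WeightedGraph V)

/-- The weighted degree. -/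
noncomputable def deg (v : V) : ℝ := ∑ u, G.weight v u

/-- The transition probability of the random walk from `u` to `v`. -/
noncomputable def step (u v : V) : ℝ := G.weight u v / G.deg u

/-- The stationary distribution of the random walk. -/
noncomputable def stationary (v : V) : ℝ := G.deg v / ∑ u, G.deg u

/-- The distribution `Π_k` on tuples `(w_1, …, w_k)`: `w_1` is stationary, followed by `k - 1`
steps of the random walk. It is supported on the collection `W_G(k)` of walks
(with `k` vertices) in `G`. -/
noncomputable def walkDist : (k : ℕ) → (Fin k → V) → ℝ
  | 0, _ => 1
  | l + 1, w => G.stationary (w 0) * ∏ i : Fin l, G.step (w i.castSucc) (w i.succ)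

/-- The normalized random walk operator of `G` in its symmetric form `D^{-1/2} W D^{-1/2}`. It is
the matrix of the walk operator `D^{-1} W` in the orthonormal basis of rescaled point masses
of `L²(stationary)`, hence has the same eigenvalues. -/
noncomputable def normAdj : Matrix V V ℝ :=
  Matrix.of fun u v => G.weight u v / (√(G.deg u) * √(G.deg v))

theorem normAdj_isHermitian : G.normAdj.IsHermitian := by
  ext u v
  simp [normAdj, G.weight_symm u v, mul_comm]

/-- `G` is a `γ`-two-sided expander: if `λ_1 ≥ λ_2 ≥ … ≥ λ_n` are the eigenvalues (with
multiplicity) of the normalized random walk operator, so that `λ_1 = 1`, then `|λ_i| ≤ γ` for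
all `i ≥ 2`. (`eigenvalues₀` lists the eigenvalues in decreasing order, starting at index `0`.) -/
def IsTwoSidedExpander [DecidableEq V] (γ : ℝ) : Prop :=
  ∀ i : Fin (Fintype.card V), 0 < i.val → |G.normAdj_isHermitian.eigenvalues₀ i| ≤ γ

end WeightedGraph

/-! ### Local PSD ensembles -/

/-- A family of (mass functions of) distributions, one on the assignments `S → A` for every finite
set `S` of variables. -/
abbrev LocalFamily (V A : Type) : Type := (S : Finset V) → (S → A) → ℝ

namespace LocalFamily

variable {V A : Type} [Fintype V] [DecidableEq V] [Fintype A] [DecidableEq A]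

/-- The probability of `Z_S = α` and `Z_T = β`, computed in the distribution of `Z_{S ∪ T}`. -/
noncomputable def pairProb (P : LocalFamily V A) (S T : Finset V) (α : S → A) (β : T → A) : ℝ :=
  ∑ χ : ↥(S ∪ T) → A,
    if Finset.restrict₂ (π := fun _ => A) Finset.subset_union_left χ = α ∧
        Finset.restrict₂ (π := fun _ => A) Finset.subset_union_right χ = β
    then P (S ∪ T) χ else 0

/-- The family conditioned on `Z_T = ξ`; meaningful if this event has positive probability. -/
noncomputable def cond (P : LocalFamily V A) (T : Finset V) (ξ : T → A) : LocalFamily V A :=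
  fun S α => P.pairProb S T α ξ / P T ξ

/-- The matrix of covariances of the indicators `1[Z_S = α]` and `1[Z_{S'} = α']`, where `S` and
`S'` satisfy a given condition `small`. -/
noncomputable def covMatrix (P : LocalFamily V A) (small : Finset V → Prop) :
    Matrix ((S : {S : Finset V // small S}) × (S.1 → A))
      ((S : {S : Finset V // small S}) × (S.1 → A)) ℝ :=
  Matrix.of fun x y => P.pairProb x.1.1 y.1.1 x.2 y.2 - P x.1.1 x.2 * P y.1.1 y.2

/-- The probability of `Z_v = a`. -/
def single (P : LocalFamily V A) (v : V) (a : A) : ℝ := P {v} fun _ => a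

/-- The joint distribution of the tuple `(Z_{f i})_i`: the probability that `Z_{f i} = a i` for all
`i`. The tuple `f` may have repeated entries. -/
noncomputable def tuple (P : LocalFamily V A) {ι : Type} [Fintype ι] (f : ι → V) (a : ι → A) : ℝ :=
  ∑ χ : ↥(Finset.univ.image f) → A,
    if ∀ i, χ ⟨f i, Finset.mem_image_of_mem f (Finset.mem_univ i)⟩ = a i
    then P (Finset.univ.image f) χ else 0

end LocalFamily

/-- A `t`-local PSD ensemble `{Z_v}_{v ∈ V}` with values in `A`: consistent probability
distributions on the assignments to every set of at most `t` variables such that, for every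
conditioning on an event `Z_T = ξ` of positive probability with `|T| ≤ t - 2`, the
covariance matrix of the indicators `1[Z_S = α]`, `|S| ≤ (t - |T|) / 2`, is positive
semidefinite. (The values `prob S` with `|S| > t` are irrelevant.) -/
structure LocalPSDEnsemble (V A : Type) [Fintype V] [DecidableEq V] [Fintype A] [DecidableEq A]
    (t : ℕ) where
  prob : LocalFamily V A
  nonneg : ∀ S : Finset V, S.card ≤ t → ∀ α, 0 ≤ prob S α
  sum_eq_one : ∀ S : Finset V, S.card ≤ t → ∑ α, prob S α = 1
  consistent : ∀ (T S : Finset V) (h : T ⊆ S), S.card ≤ t → ∀ β : T → A,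
    (∑ α : S → A, if Finset.restrict₂ (π := fun _ => A) h α = β then prob S α else 0) = prob T β
  posSemidef : ∀ (T : Finset V) (ξ : T → A), T.card + 2 ≤ t → 0 < prob T ξ →
    ((prob.cond T ξ).covMatrix fun S => 2 * S.card + T.card ≤ t).PosSemidef

/-! ### Propagation rounding and tensoriality -/

namespace LocalPSDEnsemble

variable {V A : Type} [Fintype V] [DecidableEq V] [Fintype A] [DecidableEq A]

/-- `|supp(Z_v)| ≤ q` for every variable. -/
def SupportLE {t : ℕ} (Z : LocalPSDEnsemble V A t) (q : ℕ) : Prop :=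
  ∀ v, (Finset.univ.filter fun a => Z.prob.single v a ≠ 0).card ≤ q

/-- The set of seed vertices of a sequence of tuples. -/
def seed {k m : ℕ} (s : Fin m → Fin k → V) : Finset V :=
  Finset.univ.biUnion fun j => Finset.univ.image (s j)

/-- The expectation over the slices `(m, S, σ)` of propagation rounding of a functional `F` of the
conditioned ensemble `Z' = {Z | Z_S = σ}`: `m` is uniform in `{1, …, ⌊L / k⌋}`, `S` is the union of
`m` independent tuples drawn from `Pk`, and `σ` is drawn from the distribution of `Z_S`. -/
noncomputable def sliceExpectation {t k : ℕ} (Z : LocalPSDEnsemble V A t) (Pk : (Fin k → V) → ℝ)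
    (L : ℕ) (F : LocalFamily V A → ℝ) : ℝ :=
  (∑ m ∈ Finset.Icc 1 (L / k), ∑ s : Fin m → Fin k → V, (∏ j, Pk (s j)) *
    ∑ σ : seed s → A, Z.prob (seed s) σ * F (Z.prob.cond (seed s) σ)) / ((L / k : ℕ) : ℝ)

/-- The `(μ, L)`-tensorial condition for the tuples drawn from `Pk`, with respect to the
`(L + 2k)`-local PSD ensemble `Z` given to propagation rounding. The norm is the `ℓ¹` norm
on functions of `k` letters; `k ≤ L` says that `{1, …, ⌊L / k⌋}` is not empty. -/
def IsTensorial {L k : ℕ} (Z : LocalPSDEnsemble V A (L + 2 * k)) (Pk : (Fin k → V) → ℝ)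
    (μ : ℝ) : Prop :=
  k ≤ L ∧ Z.sliceExpectation Pk L (fun Z' => ∑ w : Fin k → V, Pk w *
    ∑ a : Fin k → A, |Z'.tuple w a - ∏ i, Z'.single (w i) (a i)|) ≤ μ

/-- The `(μ, L)`-two-step tensorial condition: `(μ, L)`-tensorial and, for two independent tuples
drawn from `Pk`, the joint distribution is close to the product of the two. -/
def IsTwoStepTensorial {L k : ℕ} (Z : LocalPSDEnsemble V A (L + 2 * k)) (Pk : (Fin k → V) → ℝ)
    (μ : ℝ) : Prop :=
  Z.IsTensorial Pk μ ∧
    Z.sliceExpectation Pk L (fun Z' => ∑ s : Fin k → V, ∑ t : Fin k → V, Pk s * Pk t *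
      ∑ a : Fin k → A, ∑ b : Fin k → A,
        |Z'.tuple (Sum.elim s t) (Sum.elim a b) - Z'.tuple s a * Z'.tuple t b|) ≤ μ

end LocalPSDEnsemble

/-! The correlation of two tuples is measured by `chiSq`, the expected drop of the variances of one
when the other is revealed. The `energy` of a seed set, an average of sums of squared conditional
probabilities, lies in `[0, 1]`. By the law of total variance, conditioning on one more independent
walk raises its expectation by exactly the mean `chiSq` of two independent walks
(`sum_mul_meanChiSq`). Averaging over `m` telescopes, so the expected mean `chiSq` after rounding is
at most `1 / ⌊L/k⌋`. Cauchy–Schwarz passes from `chiSq` to the `ℓ¹` distance at the cost of a factor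
`q ^ k`, which yields the two-step condition.

For the entries of a single walk, splitting off the last vertex repeatedly reduces the claim to the
correlation of a prefix with the next vertex. These are dependent, and expansion enters here.
Positive semidefiniteness writes covariances as inner products `⟨β_a, β_b⟩`, so the `ℓ²` correlation
`∑ ⟨β_a, β_b⟩²` is the inner product of the matrix `∑ β_a β_aᵀ` of the prefix with that of the
vertex, both of Frobenius norm at most `1`. The mixing lemma, applied entry by entry, replaces the
next vertex by an independent stationary one with total error `γ` (`sum_walkDist_l2Cov_le`). A
prefix and an independent vertex are marginals of two independent walks, whose correlation is
already controlled. -/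

set_option linter.unusedSectionVars false

/-! ### Joint distributions of tuples and conditioning in a consistent family. -/

namespace LocalFamily

variable {V A : Type} [Fintype V] [DecidableEq V] [Fintype A] [DecidableEq A]

/-- The values on the sets of at most `n` variables are consistent probability distributions. -/
structure IsConsistent (P : LocalFamily V A) (n : ℕ) : Prop where
  nonneg : ∀ S : Finset V, S.card ≤ n → ∀ α, 0 ≤ P S α
  sum_eq_one : ∀ S : Finset V, S.card ≤ n → ∑ α, P S α = 1
  consistent : ∀ (T S : Finset V) (h : T ⊆ S), S.card ≤ n → ∀ β : T → A,
    (∑ α : S → A, if Finset.restrict₂ (π := fun _ => A) h α = β then P S α else 0) = P T β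

namespace IsConsistent

variable {P : LocalFamily V A} {n : ℕ} {ι κ : Type} [Fintype ι] [DecidableEq ι] [Fintype κ]
  [DecidableEq κ]

theorem sum_mul_restrict (hP : P.IsConsistent n) {S U : Finset V} (h : S ⊆ U) (hU : U.card ≤ n)
    (F : (S → A) → ℝ) :
    ∑ α, P S α * F α = ∑ χ : U → A, P U χ * F (fun i => χ ⟨i.1, h i.2⟩) := by
  simp_rw [← hP.consistent S U h hU, Finset.sum_mul]
  rw [Finset.sum_comm]
  refine Finset.sum_congr rfl fun χ _ => ?_
  simp only [ite_mul, zero_mul, Finset.sum_ite_eq, Finset.mem_univ, if_true]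
  rfl

/-- Any sufficiently small set containing the entries can serve as the sample space, so several
tuples can be compared inside one honest distribution. -/
theorem tuple_eq (hP : P.IsConsistent n) {U : Finset V} (hU : U.card ≤ n) {f : ι → V}
    (hf : ∀ i, f i ∈ U) (a : ι → A) :
    P.tuple f a = ∑ χ : U → A, if (fun i => χ ⟨f i, hf i⟩) = a then P U χ else 0 := by
  have h : Finset.univ.image f ⊆ U := by
    intro v hv
    obtain ⟨i, -, rfl⟩ := Finset.mem_image.1 hv
    exact hf i
  have := hP.sum_mul_restrict h hU fun α =>
    if (fun i => α ⟨f i, Finset.mem_image_of_mem f (Finset.mem_univ i)⟩) = a then 1 else 0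
  simp only [mul_ite, mul_one, mul_zero] at this
  rw [← this]
  simp only [tuple, funext_iff]

theorem sum_tuple_mul (hP : P.IsConsistent n) {U : Finset V} (hU : U.card ≤ n) {f : ι → V}
    (hf : ∀ i, f i ∈ U) (F : (ι → A) → ℝ) :
    ∑ a, P.tuple f a * F a = ∑ χ : U → A, P U χ * F (fun i => χ ⟨f i, hf i⟩) := by
  simp_rw [hP.tuple_eq hU hf, Finset.sum_mul]
  rw [Finset.sum_comm]
  refine Finset.sum_congr rfl fun χ _ => ?_
  simp only [ite_mul, zero_mul, Finset.sum_ite_eq, Finset.mem_univ, if_true]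

theorem tuple_nonneg (hP : P.IsConsistent n) {U : Finset V} (hU : U.card ≤ n) {f : ι → V}
    (hf : ∀ i, f i ∈ U) (a : ι → A) : 0 ≤ P.tuple f a := by
  rw [hP.tuple_eq hU hf]
  exact Finset.sum_nonneg fun χ _ => by split_ifs <;> simp [hP.nonneg U hU χ]

theorem sum_tuple (hP : P.IsConsistent n) {U : Finset V} (hU : U.card ≤ n) {f : ι → V}
    (hf : ∀ i, f i ∈ U) : ∑ a, P.tuple f a = 1 := by
  simpa [hP.sum_eq_one U hU] using hP.sum_tuple_mul hU hf fun _ => 1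

/-- Marginalization to a subtuple. -/
theorem sum_ite_tuple (hP : P.IsConsistent n) {U : Finset V} (hU : U.card ≤ n) {f : ι → V}
    (hf : ∀ i, f i ∈ U) (g : κ → ι) (b : κ → A) :
    ∑ a, (if a ∘ g = b then P.tuple f a else 0) = P.tuple (f ∘ g) b := by
  have := hP.sum_tuple_mul hU hf fun a => if a ∘ g = b then 1 else 0
  simp only [mul_ite, mul_one, mul_zero] at this
  rw [this, hP.tuple_eq hU (f := f ∘ g) (fun i => hf (g i))]
  rfl

theorem tuple_le_comp (hP : P.IsConsistent n) {U : Finset V} (hU : U.card ≤ n) {f : ι → V}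
    (hf : ∀ i, f i ∈ U) (g : κ → ι) (a : ι → A) :
    P.tuple f a ≤ P.tuple (f ∘ g) (a ∘ g) := by
  rw [← hP.sum_ite_tuple hU hf g]
  refine le_trans (by simp) (Finset.single_le_sum (f := fun a' => if a' ∘ g = a ∘ g then
    P.tuple f a' else 0) (fun a' _ => ?_) (Finset.mem_univ a))
  split_ifs
  exacts [hP.tuple_nonneg hU hf _, le_rfl]

/-- A surjective reindexing imposes the same constraints. It serves to permute and reassociate
blocks of variables and to remove repetitions. -/
theorem tuple_comp_surjective (hP : P.IsConsistent n) {U : Finset V} (hU : U.card ≤ n) {f : ι → V}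
    (hf : ∀ i, f i ∈ U) {g : κ → ι} (hg : Function.Surjective g) (a : ι → A) :
    P.tuple (f ∘ g) (a ∘ g) = P.tuple f a := by
  rw [hP.tuple_eq hU hf, hP.tuple_eq hU (f := f ∘ g) (fun i => hf (g i))]
  refine Finset.sum_congr rfl fun χ _ => if_congr ?_ rfl rfl
  exact (hg.injective_comp_right.eq_iff (a := fun i => χ ⟨f i, hf i⟩) (b := a))

theorem tuple_val (hP : P.IsConsistent n) {T : Finset V} (hT : T.card ≤ n) (α : T → A) :
    P.tuple (Subtype.val : T → V) α = P T α := by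
  rw [hP.tuple_eq hT (fun i => i.2)]
  simp

theorem tuple_const (hP : P.IsConsistent n) [Nonempty ι] (hn : 1 ≤ n) (v : V) (a : A) :
    P.tuple (fun _ : ι => v) (fun _ => a) = P.single v a := by
  have h1 : ({v} : Finset V).card ≤ n := by simpa using hn
  have := hP.tuple_comp_surjective h1 (f := (Subtype.val : ({v} : Finset V) → V)) (fun i => i.2)
    (g := fun _ : ι => ⟨v, by simp⟩) (fun x => ⟨Classical.arbitrary ι, by
      ext; exact (Finset.mem_singleton.1 x.2).symm⟩) (fun _ => a)
  rw [hP.tuple_val h1] at this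
  exact this

theorem tuple_eq_zero_of_single (hP : P.IsConsistent n) {U : Finset V} (hU : U.card ≤ n)
    (hn : 1 ≤ n) {f : ι → V} (hf : ∀ i, f i ∈ U) {a : ι → A} {i : ι}
    (h : P.single (f i) (a i) = 0) : P.tuple f a = 0 := by
  refine le_antisymm ?_ (hP.tuple_nonneg hU hf a)
  refine (hP.tuple_le_comp hU hf (fun _ : Unit => i) a).trans_eq ?_
  rw [← h, ← hP.tuple_const (ι := Unit) hn]
  rfl

/-- Summing out the second tuple. -/
theorem sum_tuple_elim_left (hP : P.IsConsistent n) {U : Finset V} (hU : U.card ≤ n) {f : ι → V}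
    {g : κ → V} (hf : ∀ i, f i ∈ U) (hg : ∀ i, g i ∈ U) (a : ι → A) :
    ∑ b, P.tuple (Sum.elim f g) (Sum.elim a b) = P.tuple f a := by
  have hfg : ∀ i, Sum.elim f g i ∈ U := by rintro (i | i) <;> simp [hf, hg]
  have := hP.sum_ite_tuple hU hfg Sum.inl a
  rw [Sum.elim_comp_inl] at this
  rw [← this, ← (Equiv.sumArrowEquivProdArrow ι κ A).symm.sum_comp, Fintype.sum_prod_type,
    Finset.sum_comm]
  refine Finset.sum_congr rfl fun b _ => ?_
  simp [Equiv.sumArrowEquivProdArrow, funext_iff]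
  simp [← funext_iff]

theorem tuple_elim_swap (hP : P.IsConsistent n) {U : Finset V} (hU : U.card ≤ n) {f : ι → V}
    {g : κ → V} (hf : ∀ i, f i ∈ U) (hg : ∀ i, g i ∈ U) (a : ι → A) (b : κ → A) :
    P.tuple (Sum.elim g f) (Sum.elim b a) = P.tuple (Sum.elim f g) (Sum.elim a b) := by
  have hfg : ∀ i, Sum.elim f g i ∈ U := by rintro (i | i) <;> simp [hf, hg]
  rw [← hP.tuple_comp_surjective hU hfg (g := Sum.swap) Sum.swap_leftInverse.surjective]
  congr 1 <;> ext (i | i) <;> rfl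

/-- Summing out the first tuple. -/
theorem sum_tuple_elim_right (hP : P.IsConsistent n) {U : Finset V} (hU : U.card ≤ n) {f : ι → V}
    {g : κ → V} (hf : ∀ i, f i ∈ U) (hg : ∀ i, g i ∈ U) (b : κ → A) :
    ∑ a, P.tuple (Sum.elim f g) (Sum.elim a b) = P.tuple g b := by
  simp_rw [← hP.tuple_elim_swap hU hf hg]
  exact hP.sum_tuple_elim_left hU hg hf b

theorem tuple_elim_le_left (hP : P.IsConsistent n) {U : Finset V} (hU : U.card ≤ n) {f : ι → V}
    {g : κ → V} (hf : ∀ i, f i ∈ U) (hg : ∀ i, g i ∈ U) (a : ι → A) (b : κ → A) :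
    P.tuple (Sum.elim f g) (Sum.elim a b) ≤ P.tuple f a := by
  have hfg : ∀ i, Sum.elim f g i ∈ U := by rintro (i | i) <;> simp [hf, hg]
  simpa using hP.tuple_le_comp hU hfg Sum.inl (Sum.elim a b)

theorem tuple_elim_le_right (hP : P.IsConsistent n) {U : Finset V} (hU : U.card ≤ n) {f : ι → V}
    {g : κ → V} (hf : ∀ i, f i ∈ U) (hg : ∀ i, g i ∈ U) (a : ι → A) (b : κ → A) :
    P.tuple (Sum.elim f g) (Sum.elim a b) ≤ P.tuple g b := by
  have hfg : ∀ i, Sum.elim f g i ∈ U := by rintro (i | i) <;> simp [hf, hg]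
  simpa using hP.tuple_le_comp hU hfg Sum.inr (Sum.elim a b)

theorem pairProb_eq (hP : P.IsConsistent n) {S T U : Finset V} (hU : U.card ≤ n)
    (hS : S ⊆ U) (hT : T ⊆ U) (α : S → A) (β : T → A) :
    P.pairProb S T α β = ∑ χ : U → A, if (fun i : S => χ ⟨i.1, hS i.2⟩) = α ∧
      (fun i : T => χ ⟨i.1, hT i.2⟩) = β then P U χ else 0 := by
  have := hP.sum_mul_restrict (Finset.union_subset hS hT) hU fun χ =>
    if Finset.restrict₂ (π := fun _ => A) Finset.subset_union_left χ = α ∧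
        Finset.restrict₂ (π := fun _ => A) Finset.subset_union_right χ = β then 1 else 0
  simp only [mul_ite, mul_one, mul_zero] at this
  rw [pairProb, this]
  rfl

theorem sum_pairProb_mul (hP : P.IsConsistent n) {S T U : Finset V} (hU : U.card ≤ n)
    (hS : S ⊆ U) (hT : T ⊆ U) (β : T → A) (F : (S → A) → ℝ) :
    ∑ α, P.pairProb S T α β * F α = ∑ χ : U → A, if (fun i : T => χ ⟨i.1, hT i.2⟩) = β then
      P U χ * F (fun i : S => χ ⟨i.1, hS i.2⟩) else 0 := by
  simp_rw [hP.pairProb_eq hU hS hT, Finset.sum_mul]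
  rw [Finset.sum_comm]
  refine Finset.sum_congr rfl fun χ _ => ?_
  simp only [ite_and, ite_mul, zero_mul, Finset.sum_ite_eq, Finset.mem_univ, if_true]

theorem cond_tuple (hP : P.IsConsistent n) {T U : Finset V} (hU : U.card ≤ n) (hT : T ⊆ U)
    {f : ι → V} (hf : ∀ i, f i ∈ U) (ξ : T → A) (a : ι → A) :
    (P.cond T ξ).tuple f a =
      P.tuple (Sum.elim f (Subtype.val : T → V)) (Sum.elim a ξ) / P T ξ := by
  have h : Finset.univ.image f ⊆ U := by
    intro v hv
    obtain ⟨i, -, rfl⟩ := Finset.mem_image.1 hv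
    exact hf i
  have key := hP.sum_pairProb_mul hU h hT ξ fun α =>
    if (fun i => α ⟨f i, Finset.mem_image_of_mem f (Finset.mem_univ i)⟩) = a then 1 else 0
  simp only [mul_ite, mul_one, mul_zero] at key
  have hfT : ∀ i, Sum.elim f (Subtype.val : T → V) i ∈ U := by
    rintro (i | i)
    exacts [hf i, hT i.2]
  rw [hP.tuple_eq hU hfT]
  have h1 : (P.cond T ξ).tuple f a = (∑ α : Finset.univ.image f → A,
      if (fun i => α ⟨f i, Finset.mem_image_of_mem f (Finset.mem_univ i)⟩) = a
      then P.pairProb (Finset.univ.image f) T α ξ else 0) / P T ξ := by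
    rw [Finset.sum_div]
    refine Finset.sum_congr rfl fun χ _ => ?_
    simp only [cond, funext_iff, ite_div, zero_div]
  rw [h1, key]
  congr 1
  refine Finset.sum_congr rfl fun χ _ => ?_
  rw [← ite_and]
  refine if_congr ?_ rfl rfl
  simp only [funext_iff, Sum.forall, Sum.elim_inl, Sum.elim_inr]
  exact and_comm

/-- A conditional probability on `S` is read off from `S ∪ T`, so conditioning costs `T.card` of the
locality. -/
theorem cond_isConsistent (hP : P.IsConsistent n) {T : Finset V} {r : ℕ} (hT : T.card + r ≤ n)
    {ξ : T → A} (hξ : 0 < P T ξ) : (P.cond T ξ).IsConsistent r := by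
  have card_le : ∀ S : Finset V, S.card ≤ r → (S ∪ T).card ≤ n := fun S hS =>
    (Finset.card_union_le S T).trans (by omega)
  refine ⟨fun S hS α => ?_, fun S hS => ?_, fun S' S h hS β => ?_⟩
  · refine div_nonneg (Finset.sum_nonneg fun χ _ => ?_) hξ.le
    split_ifs
    exacts [hP.nonneg _ (card_le S hS) χ, le_rfl]
  · have := hP.sum_pairProb_mul (card_le S hS) Finset.subset_union_left
      Finset.subset_union_right ξ fun _ => 1
    simp only [mul_one] at this
    simp only [cond, ← Finset.sum_div, this]
    rw [div_eq_one_iff_eq hξ.ne']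
    exact hP.consistent _ _ Finset.subset_union_right (card_le S hS) ξ
  · have h1 := hP.sum_pairProb_mul (card_le S hS) Finset.subset_union_left
      Finset.subset_union_right ξ fun α => if Finset.restrict₂ (π := fun _ => A) h α = β then 1 else 0
    simp only [mul_ite, mul_one, mul_zero] at h1
    have h2 := hP.pairProb_eq (card_le S hS) (h.trans Finset.subset_union_left)
      Finset.subset_union_right β ξ
    simp only [cond]
    rw [h2]
    trans (∑ α : S → A, if Finset.restrict₂ (π := fun _ => A) h α = β then
      P.pairProb S T α ξ else 0) / P T ξ
    · rw [Finset.sum_div]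
      exact Finset.sum_congr rfl fun χ _ => by split_ifs <;> simp
    · rw [h1]
      congr 1
      refine Finset.sum_congr rfl fun χ _ => ?_
      rw [← ite_and]
      exact if_congr and_comm rfl rfl

end IsConsistent
end LocalFamily

/-! ### Covariances as inner products. -/

namespace LocalFamily

variable {V A : Type} [Fintype V] [DecidableEq V] [Fintype A] [DecidableEq A]

theorem covMatrix_posSemidef_mono {P : LocalFamily V A} {small small' : Finset V → Prop}
    (h : ∀ S, small' S → small S) (hP : (P.covMatrix small).PosSemidef) :
    (P.covMatrix small').PosSemidef := by
  let e : ((S : {S : Finset V // small' S}) × (S.1 → A)) →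
      (S : {S : Finset V // small S}) × (S.1 → A) := fun x => ⟨⟨x.1.1, h _ x.1.2⟩, x.2⟩
  exact hP.submatrix e

/-- The covariance of `1[Z_f = a]` and `1[Z_g = b]`. -/
noncomputable def cov (P : LocalFamily V A) {ι κ : Type} [Fintype ι] [Fintype κ] (f : ι → V)
    (g : κ → V) (a : ι → A) (b : κ → A) : ℝ :=
  P.tuple (Sum.elim f g) (Sum.elim a b) - P.tuple f a * P.tuple g b

/-- The vector of the event `Z_f = a`, given the vectors of the events `Z_S = α`. -/
noncomputable def eventVector {N : Type} (β : (S : Finset V) → (S → A) → N → ℝ) {ι : Type}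
    [Fintype ι] (f : ι → V) (a : ι → A) (i : N) : ℝ :=
  ∑ χ : ↥(Finset.univ.image f) → A,
    if ∀ i, χ ⟨f i, Finset.mem_image_of_mem f (Finset.mem_univ i)⟩ = a i
    then β (Finset.univ.image f) χ i else 0

namespace IsConsistent

variable {P : LocalFamily V A} {n : ℕ} {ι κ : Type} [Fintype ι] [DecidableEq ι] [Fintype κ]
  [DecidableEq κ]

theorem sum_sum_pairProb (hP : P.IsConsistent n) {U : Finset V} (hU : U.card ≤ n) {f : ι → V}
    {g : κ → V} (hf : ∀ i, f i ∈ U) (hg : ∀ i, g i ∈ U) (a : ι → A) (b : κ → A) :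
    (∑ χ : ↥(Finset.univ.image f) → A, ∑ ψ : ↥(Finset.univ.image g) → A,
      if (∀ i, χ ⟨f i, Finset.mem_image_of_mem f (Finset.mem_univ i)⟩ = a i) ∧
        (∀ i, ψ ⟨g i, Finset.mem_image_of_mem g (Finset.mem_univ i)⟩ = b i)
      then P.pairProb (Finset.univ.image f) (Finset.univ.image g) χ ψ else 0) =
      P.tuple (Sum.elim f g) (Sum.elim a b) := by
  have hf' : Finset.univ.image f ⊆ U := Finset.image_subset_iff.2 fun i _ => hf i
  have hg' : Finset.univ.image g ⊆ U := Finset.image_subset_iff.2 fun i _ => hg i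
  have hfg : ∀ i, Sum.elim f g i ∈ U := by rintro (i | i) <;> simp [hf, hg]
  rw [hP.tuple_eq hU hfg, Finset.sum_comm]
  have h1 : ∀ ψ : ↥(Finset.univ.image g) → A, (∑ χ : ↥(Finset.univ.image f) → A,
      if (∀ i, χ ⟨f i, Finset.mem_image_of_mem f (Finset.mem_univ i)⟩ = a i) ∧
        (∀ i, ψ ⟨g i, Finset.mem_image_of_mem g (Finset.mem_univ i)⟩ = b i)
      then P.pairProb (Finset.univ.image f) (Finset.univ.image g) χ ψ else 0) =
      ∑ η : U → A, if (fun i : ↥(Finset.univ.image g) => η ⟨i.1, hg' i.2⟩) = ψ then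
        (if (∀ i, η ⟨f i, hf i⟩ = a i) ∧
          (∀ i, ψ ⟨g i, Finset.mem_image_of_mem g (Finset.mem_univ i)⟩ = b i)
        then P U η else 0) else 0 := by
    intro ψ
    have := hP.sum_pairProb_mul hU hf' hg' ψ fun χ =>
      if (∀ i, χ ⟨f i, Finset.mem_image_of_mem f (Finset.mem_univ i)⟩ = a i) ∧
        (∀ i, ψ ⟨g i, Finset.mem_image_of_mem g (Finset.mem_univ i)⟩ = b i) then 1 else 0
    simpa only [mul_ite, mul_one, mul_zero] using this
  simp_rw [h1]
  rw [Finset.sum_comm]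
  refine Finset.sum_congr rfl fun η _ => ?_
  rw [Finset.sum_ite_eq]
  simp only [Finset.mem_univ, if_true, funext_iff, Sum.forall, Sum.elim_inl, Sum.elim_inr]

theorem card_image_union_le {k : ℕ} (hι : Fintype.card ι ≤ k) (hκ : Fintype.card κ ≤ k)
    (f : ι → V) (g : κ → V) :
    (Finset.univ.image f ∪ Finset.univ.image g).card ≤ 2 * k := by
  refine (Finset.card_union_le _ _).trans ?_
  have h1 := (Finset.card_image_le (s := Finset.univ) (f := f))
  have h2 := (Finset.card_image_le (s := Finset.univ) (f := g))
  rw [Finset.card_univ] at h1 h2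
  omega

open scoped MatrixOrder in
/-- The covariances of events on at most `k` variables are inner products. -/
theorem exists_gram {k : ℕ} (hP : P.IsConsistent (2 * k))
    (hpsd : (P.covMatrix fun S => S.card ≤ k).PosSemidef) :
    ∃ (N : Type) (_ : Fintype N) (β : (S : Finset V) → (S → A) → N → ℝ),
      ∀ {ι κ : Type} [Fintype ι] [DecidableEq ι] [Fintype κ] [DecidableEq κ],
        Fintype.card ι ≤ k → Fintype.card κ ≤ k → ∀ (f : ι → V) (g : κ → V) (a : ι → A)
        (b : κ → A), P.cov f g a b = ∑ i, eventVector β f a i * eventVector β g b i := by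
  classical
  obtain ⟨B, hB⟩ := CStarAlgebra.nonneg_iff_eq_star_mul_self.mp hpsd.nonneg
  -- The Gram vectors are the columns of the factor `B`. Sets of more than `k` variables get the
  -- default `0`, which is never met since a tuple of length at most `k` has at most `k` entries.
  refine ⟨_, inferInstance, fun S α i => if h : S.card ≤ k then B i ⟨⟨S, h⟩, α⟩ else 0, ?_⟩
  intro ι κ _ _ _ _ hι hκ f g a b
  have hfk : (Finset.univ.image f).card ≤ k := Finset.card_image_le.trans (by simpa using hι)
  have hgk : (Finset.univ.image g).card ≤ k := Finset.card_image_le.trans (by simpa using hκ)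
  rw [cov, ← hP.sum_sum_pairProb (card_image_union_le hι hκ f g)
    (fun i => Finset.mem_union_left _ (Finset.mem_image_of_mem f (Finset.mem_univ i)))
    (fun i => Finset.mem_union_right _ (Finset.mem_image_of_mem g (Finset.mem_univ i)))]
  simp only [eventVector, tuple, dif_pos hfk, dif_pos hgk]
  simp_rw [Finset.sum_mul_sum]
  rw [← Finset.sum_sub_distrib, Finset.sum_comm]
  refine Finset.sum_congr rfl fun χ _ => ?_
  rw [← Finset.sum_sub_distrib, Finset.sum_comm]
  refine Finset.sum_congr rfl fun ψ _ => ?_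
  have h := congrFun₂ hB ⟨⟨_, hfk⟩, χ⟩ ⟨⟨_, hgk⟩, ψ⟩
  simp only [covMatrix, Matrix.of_apply, Matrix.mul_apply, Matrix.star_apply,
    star_trivial] at h
  by_cases h1 : ∀ i, χ ⟨f i, Finset.mem_image_of_mem f (Finset.mem_univ i)⟩ = a i <;>
  by_cases h2 : ∀ i, ψ ⟨g i, Finset.mem_image_of_mem g (Finset.mem_univ i)⟩ = b i <;>
  simp [h1, h2, h]

/-- A sum over the assignments to a tuple which vanishes where the tuple has probability `0` is a
sum over the assignments to its set of entries. -/
theorem sum_comp_image (f : ι → V) (H : (ι → A) → ℝ) (hH : ∀ a, P.tuple f a = 0 → H a = 0) :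
    ∑ a, H a = ∑ σ : ↥(Finset.univ.image f) → A,
      H fun i => σ ⟨f i, Finset.mem_image_of_mem f (Finset.mem_univ i)⟩ := by
  symm
  refine Finset.sum_of_injOn (fun σ i => σ ⟨f i, Finset.mem_image_of_mem f (Finset.mem_univ i)⟩)
    ?_ (fun _ _ => Finset.mem_coe.2 (Finset.mem_univ _)) ?_ (fun _ _ => rfl)
  · intro σ _ τ _ h
    ext ⟨v, hv⟩
    obtain ⟨i, -, rfl⟩ := Finset.mem_image.1 hv
    exact congrFun h i
  · intro a _ ha
    refine hH a (Finset.sum_eq_zero fun χ _ => if_neg fun h => ha ⟨χ, by simp, funext h⟩)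

end IsConsistent
end LocalFamily

/-! ### The energy increment. -/

/-- Law of total variance for one indicator inside the event `Z_T = σ` of probability `p`: `x b`, `y
b` and `r` are the probabilities of this event together with `Z_s = a, Z_t = b`, with `Z_t = b`, and
with `Z_s = a`. Where `y b = 0` also `x b = 0`, so division by zero does no harm. -/
theorem sum_conditional_variance {β : Type} [Fintype β] {x y : β → ℝ} {p r : ℝ} (hp : 0 < p)
    (hx : ∀ b, 0 ≤ x b) (hxy : ∀ b, x b ≤ y b) (hxr : ∑ b, x b = r) (hyp : ∑ b, y b = p) :
    p * ∑ b, (x b / p - r / p * (y b / p)) ^ 2 / (y b / p) = ∑ b, x b ^ 2 / y b - r ^ 2 / p := by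
  have key : ∀ b, p * ((x b / p - r / p * (y b / p)) ^ 2 / (y b / p)) =
      x b ^ 2 / y b - 2 * (r / p) * x b + r ^ 2 / p ^ 2 * y b := by
    intro b
    rcases eq_or_ne (y b) 0 with h | h
    · have : x b = 0 := le_antisymm (h ▸ hxy b) (hx b)
      simp [h, this]
    · field_simp
      ring
  rw [Finset.mul_sum, Finset.sum_congr rfl fun b _ => key b, Finset.sum_add_distrib,
    Finset.sum_sub_distrib, ← Finset.mul_sum, ← Finset.mul_sum, hxr, hyp]
  field_simp
  ring

namespace LocalFamily

variable {V A : Type} [Fintype V] [DecidableEq V] [Fintype A] [DecidableEq A]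

/-- The expected drop of the variances of the indicators `1[Z_f = a]` when `Z_g` is revealed. -/
noncomputable def chiSq (P : LocalFamily V A) {ι κ : Type} [Fintype ι] [DecidableEq ι] [Fintype κ]
    [DecidableEq κ] (f : ι → V) (g : κ → V) : ℝ :=
  ∑ a, ∑ b, P.cov f g a b ^ 2 / P.tuple g b

/-- The average of `chiSq` over two independent tuples. -/
noncomputable def meanChiSq (P : LocalFamily V A) {k : ℕ} (D : (Fin k → V) → ℝ) : ℝ :=
  ∑ s, ∑ t, D s * D t * P.chiSq s t

/-- The average over `w` of the sum of the expected squares of the probabilities of `Z_w = a`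
conditioned on `Z_T`. -/
noncomputable def energy (P : LocalFamily V A) {k : ℕ} (D : (Fin k → V) → ℝ) (T : Finset V) : ℝ :=
  ∑ w, D w * ∑ a, ∑ σ : T → A,
    P.tuple (Sum.elim w (Subtype.val : T → V)) (Sum.elim a σ) ^ 2 / P T σ

namespace IsConsistent

variable {P : LocalFamily V A} {n : ℕ} {ι κ : Type} [Fintype ι] [DecidableEq ι] [Fintype κ]
  [DecidableEq κ]

/-- Passes from a set of seeds to a tuple listing it, possibly with repetitions, so that adding
seeds becomes concatenation. Inconsistent assignments to repeated entries have probability `0` and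
contribute nothing. -/
theorem energy_image (hP : P.IsConsistent n) {k : ℕ} (D : (Fin k → V) → ℝ) (f : ι → V)
    (hn : (Finset.univ.image f).card + k ≤ n) :
    P.energy D (Finset.univ.image f) = ∑ w, D w * ∑ a, ∑ σ : ι → A,
      P.tuple (Sum.elim w f) (Sum.elim a σ) ^ 2 / P.tuple f σ := by
  refine Finset.sum_congr rfl fun w _ => congrArg (D w * ·) (Finset.sum_congr rfl fun a _ => ?_)
  rw [sum_comp_image (P := P) f _ fun σ hσ => by simp [hσ]]
  have hU : (Finset.univ.image w ∪ Finset.univ.image f).card ≤ n := by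
    refine (Finset.card_union_le _ _).trans ?_
    have := Finset.card_image_le (s := Finset.univ) (f := w)
    simp only [Finset.card_univ, Fintype.card_fin] at this
    omega
  refine Finset.sum_congr rfl fun σ _ => ?_
  let e : ι → Finset.univ.image f := fun i =>
    ⟨f i, Finset.mem_image_of_mem f (Finset.mem_univ i)⟩
  have he : Function.Surjective e := by
    rintro ⟨v, hv⟩
    obtain ⟨i, -, rfl⟩ := Finset.mem_image.1 hv
    exact ⟨i, rfl⟩
  have h1 := hP.tuple_comp_surjective hU (f := (Subtype.val : Finset.univ.image f → V))
    (fun i => Finset.mem_union_right _ i.2) he σ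
  rw [hP.tuple_val (by omega)] at h1
  have h2 := hP.tuple_comp_surjective hU
    (f := Sum.elim w (Subtype.val : Finset.univ.image f → V)) (by
      rintro (i | i)
      · exact Finset.mem_union_left _ (Finset.mem_image_of_mem _ (Finset.mem_univ _))
      · exact Finset.mem_union_right _ i.2) (Function.Surjective.sumMap Function.surjective_id he)
    (Sum.elim a σ)
  rw [← h1, ← h2, Sum.elim_comp_map, Sum.elim_comp_map]
  rfl

theorem energy_nonneg (hP : P.IsConsistent n) {k : ℕ} {D : (Fin k → V) → ℝ} (hD : ∀ w, 0 ≤ D w)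
    {T : Finset V} (hT : T.card ≤ n) : 0 ≤ P.energy D T :=
  Finset.sum_nonneg fun w _ => mul_nonneg (hD w) <| Finset.sum_nonneg fun _ _ =>
    Finset.sum_nonneg fun σ _ => div_nonneg (sq_nonneg _) (hP.nonneg T hT σ)

theorem energy_le_one (hP : P.IsConsistent n) {k : ℕ} {D : (Fin k → V) → ℝ} (hD : ∀ w, 0 ≤ D w)
    (hD1 : ∑ w, D w = 1) {T : Finset V} (hT : T.card + k ≤ n) : P.energy D T ≤ 1 := by
  rw [← hD1]
  refine Finset.sum_le_sum fun w _ => mul_le_of_le_one_right (hD w) ?_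
  have hU : (Finset.univ.image w ∪ T).card ≤ n := by
    refine (Finset.card_union_le _ _).trans ?_
    have := Finset.card_image_le (s := Finset.univ) (f := w)
    simp only [Finset.card_univ, Fintype.card_fin] at this
    omega
  have hw : ∀ i, w i ∈ Finset.univ.image w ∪ T := fun i =>
    Finset.mem_union_left _ (Finset.mem_image_of_mem _ (Finset.mem_univ _))
  have hTU : ∀ i : T, i.1 ∈ Finset.univ.image w ∪ T := fun i => Finset.mem_union_right _ i.2
  rw [Finset.sum_comm, ← hP.sum_eq_one T (by omega)]
  refine Finset.sum_le_sum fun σ _ => ?_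
  calc ∑ a, P.tuple (Sum.elim w (Subtype.val : T → V)) (Sum.elim a σ) ^ 2 / P T σ
      ≤ ∑ a, P.tuple (Sum.elim w (Subtype.val : T → V)) (Sum.elim a σ) := by
        refine Finset.sum_le_sum fun a _ => ?_
        have h0 := hP.tuple_nonneg hU (f := Sum.elim w (Subtype.val : T → V))
          (by rintro (i | i); exacts [hw i, hTU i]) (Sum.elim a σ)
        have h1 := hP.tuple_elim_le_right hU hw hTU a σ
        rw [hP.tuple_val (by omega)] at h1
        refine div_le_of_le_mul₀ (h0.trans h1) h0 ?_
        rw [sq]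
        exact mul_le_mul_of_nonneg_left h1 h0
    _ = P T σ := by
        rw [hP.sum_tuple_elim_right hU hw hTU, hP.tuple_val (by omega)]

/-- Conditioning on one more tuple raises the expected energy by the average `chiSq`. -/
theorem sum_mul_meanChiSq (hP : P.IsConsistent n) {k : ℕ} {D : (Fin k → V) → ℝ}
    (hD1 : ∑ w, D w = 1) {T : Finset V} (hT : T.card + 2 * k ≤ n) :
    ∑ σ, P T σ * (P.cond T σ).meanChiSq D =
      ∑ t, D t * P.energy D (T ∪ Finset.univ.image t) - P.energy D T := by
  have hcard : ∀ w : Fin k → V, (Finset.univ.image w).card ≤ k := fun w => by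
    simpa using Finset.card_image_le (s := Finset.univ) (f := w)
  have him : ∀ t : Fin k → V, T ∪ Finset.univ.image t =
      Finset.univ.image (Sum.elim t (Subtype.val : T → V)) := by
    intro t
    ext v
    simp [or_comm]
  have hE : ∀ t : Fin k → V, P.energy D (T ∪ Finset.univ.image t) = ∑ w, D w * ∑ a,
      ∑ σ : T → A, ∑ b : Fin k → A,
        P.tuple (Sum.elim w (Sum.elim t (Subtype.val : T → V))) (Sum.elim a (Sum.elim b σ)) ^ 2 /
          P.tuple (Sum.elim t (Subtype.val : T → V)) (Sum.elim b σ) := by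
    intro t
    rw [him, hP.energy_image D _ (by
      rw [← him]
      have := Finset.card_union_le T (Finset.univ.image t)
      have := hcard t
      omega)]
    refine Finset.sum_congr rfl fun w _ => congrArg (D w * ·) (Finset.sum_congr rfl fun a _ => ?_)
    rw [← (Equiv.sumArrowEquivProdArrow (Fin k) T A).symm.sum_comp, Fintype.sum_prod_type,
      Finset.sum_comm]
    rfl
  -- The increment holds already for each fixed `s`, `t`, `σ`, `a`, before any averaging.
  have key : ∀ (s t : Fin k → V) (σ : T → A) (a : Fin k → A),
      P T σ * ∑ b, (P.cond T σ).cov s t a b ^ 2 / (P.cond T σ).tuple t b =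
      ∑ b : Fin k → A, P.tuple (Sum.elim s (Sum.elim t (Subtype.val : T → V)))
        (Sum.elim a (Sum.elim b σ)) ^ 2 /
          P.tuple (Sum.elim t (Subtype.val : T → V)) (Sum.elim b σ) -
      P.tuple (Sum.elim s (Subtype.val : T → V)) (Sum.elim a σ) ^ 2 / P T σ := by
    intro s t σ a
    obtain ⟨U, hUdef⟩ : ∃ U, U = Finset.univ.image s ∪ (Finset.univ.image t ∪ T) := ⟨_, rfl⟩
    have hU : U.card ≤ n := by
      rw [hUdef]
      have h1 := Finset.card_union_le (Finset.univ.image s) (Finset.univ.image t ∪ T)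
      have h2 := Finset.card_union_le (Finset.univ.image t) T
      have h3 := hcard s
      have h4 := hcard t
      omega
    have hs : ∀ i, s i ∈ U := fun i => by simp [hUdef]
    have ht : ∀ i, t i ∈ U := fun i => by simp [hUdef]
    have hTU : T ⊆ U := fun i hi => by simp [hUdef, hi]
    have hst : ∀ i, Sum.elim s t i ∈ U := by rintro (i | i); exacts [hs i, ht i]
    have htT : ∀ i, Sum.elim t (Subtype.val : T → V) i ∈ U := by
      rintro (i | i); exacts [ht i, hTU i.2]
    have hsT : ∀ i, Sum.elim s (Subtype.val : T → V) i ∈ U := by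
      rintro (i | i); exacts [hs i, hTU i.2]
    have hstT : ∀ i, Sum.elim s (Sum.elim t (Subtype.val : T → V)) i ∈ U := by
      rintro (i | i); exacts [hs i, htT i]
    have hval := hP.tuple_val (T := T) (by omega) σ
    have assoc : ∀ b : Fin k → A,
        P.tuple (Sum.elim (Sum.elim s t) (Subtype.val : T → V)) (Sum.elim (Sum.elim a b) σ) =
        P.tuple (Sum.elim s (Sum.elim t (Subtype.val : T → V))) (Sum.elim a (Sum.elim b σ)) := by
      intro b
      rw [← hP.tuple_comp_surjective hU hstT
        (g := Equiv.sumAssoc (Fin k) (Fin k) T) (Equiv.surjective _)]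
      congr 1 <;> ext ((i | i) | i) <;> rfl
    have hle : ∀ b : Fin k → A,
        P.tuple (Sum.elim s (Sum.elim t (Subtype.val : T → V))) (Sum.elim a (Sum.elim b σ)) ≤
        P.tuple (Sum.elim t (Subtype.val : T → V)) (Sum.elim b σ) := fun b =>
      hP.tuple_elim_le_right hU hs htT a _
    have hsum : ∑ b : Fin k → A,
        P.tuple (Sum.elim s (Sum.elim t (Subtype.val : T → V))) (Sum.elim a (Sum.elim b σ)) =
        P.tuple (Sum.elim s (Subtype.val : T → V)) (Sum.elim a σ) := by
      rw [← hP.sum_tuple_elim_right hU ht hsT (Sum.elim a σ)]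
      refine Finset.sum_congr rfl fun b _ => ?_
      -- The blocks `s` and `t` are swapped so that the one summed over comes first.
      rw [← hP.tuple_comp_surjective hU (f := Sum.elim t (Sum.elim s (Subtype.val : T → V)))
        (by rintro (i | i); exacts [ht i, hsT i])
        (g := (fun x => Sum.elim (fun i => Sum.inr (Sum.inl i))
          (Sum.elim Sum.inl (fun i => Sum.inr (Sum.inr i))) x :
          Fin k ⊕ (Fin k ⊕ T) → Fin k ⊕ (Fin k ⊕ T)))
        (by
          rintro (i | i | i)
          exacts [⟨Sum.inr (Sum.inl i), rfl⟩, ⟨Sum.inl i, rfl⟩, ⟨Sum.inr (Sum.inr i), rfl⟩])]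
      congr 1 <;> ext (i | i | i) <;> rfl
    have hsum' : ∑ b : Fin k → A, P.tuple (Sum.elim t (Subtype.val : T → V)) (Sum.elim b σ) =
        P T σ := by
      rw [hP.sum_tuple_elim_right hU ht (fun i => hTU i.2), hval]
    have hnn : ∀ b : Fin k → A, 0 ≤ P.tuple (Sum.elim s (Sum.elim t (Subtype.val : T → V)))
        (Sum.elim a (Sum.elim b σ)) := fun b => hP.tuple_nonneg hU hstT _
    rcases (hP.nonneg T (by omega) σ).eq_or_lt with h0 | hpos
    · have hz : ∀ b : Fin k → A, P.tuple (Sum.elim t (Subtype.val : T → V)) (Sum.elim b σ) = 0 :=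
        fun b => le_antisymm (by
          rw [h0, ← hval]
          exact hP.tuple_elim_le_right hU ht (fun i => hTU i.2) b σ) (hP.tuple_nonneg hU htT _)
      simp [← h0, hz]
    · rw [← sum_conditional_variance hpos hnn hle hsum hsum']
      congr 1
      refine Finset.sum_congr rfl fun b _ => ?_
      rw [cov, hP.cond_tuple hU hTU hst, hP.cond_tuple hU hTU hs, hP.cond_tuple hU hTU ht, assoc]
  simp_rw [hE]
  have lhs : ∑ σ, P T σ * (P.cond T σ).meanChiSq D =
      ∑ s, ∑ t, D s * D t * ∑ a, ∑ σ, P T σ * ∑ b, (P.cond T σ).cov s t a b ^ 2 /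
        (P.cond T σ).tuple t b := by
    simp only [meanChiSq, chiSq, Finset.mul_sum]
    rw [Finset.sum_comm]
    refine Finset.sum_congr rfl fun s _ => ?_
    rw [Finset.sum_comm]
    refine Finset.sum_congr rfl fun t _ => ?_
    rw [Finset.sum_comm]
    refine Finset.sum_congr rfl fun a _ => Finset.sum_congr rfl fun σ _ =>
      Finset.sum_congr rfl fun b _ => by ring
  rw [lhs]
  simp_rw [key, Finset.sum_sub_distrib, mul_sub, Finset.sum_sub_distrib]
  congr 1
  · rw [Finset.sum_comm]
    refine Finset.sum_congr rfl fun t _ => ?_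
    rw [Finset.mul_sum]
    exact Finset.sum_congr rfl fun s _ => by ring
  · rw [energy]
    refine Finset.sum_congr rfl fun s _ => ?_
    rw [← Finset.sum_mul, ← Finset.mul_sum, hD1, mul_one]

end IsConsistent
end LocalFamily

/-! ### Telescoping over the number of seed walks. -/

namespace LocalPSDEnsemble

variable {V A : Type} [Fintype V] [DecidableEq V] [Fintype A] [DecidableEq A]

theorem isConsistent {t : ℕ} (Z : LocalPSDEnsemble V A t) : Z.prob.IsConsistent t :=
  ⟨Z.nonneg, Z.sum_eq_one, Z.consistent⟩

theorem card_seed_le {k m : ℕ} (s : Fin m → Fin k → V) : (seed s).card ≤ m * k := by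
  refine (Finset.card_biUnion_le_card_mul _ _ k fun j _ => ?_).trans (by simp)
  simpa using Finset.card_image_le (s := Finset.univ) (f := s j)

theorem seed_cons {k m : ℕ} (t : Fin k → V) (s : Fin m → Fin k → V) :
    seed (Fin.cons t s : Fin (m + 1) → Fin k → V) = seed s ∪ Finset.univ.image t := by
  ext v
  simp [seed, Fin.exists_fin_succ, or_comm]

theorem sum_prod_eq_one {X : Type} [Fintype X] {D : X → ℝ} (hD1 : ∑ x, D x = 1) (m : ℕ) :
    ∑ s : Fin m → X, ∏ j, D (s j) = 1 := by
  have := Finset.prod_univ_sum (fun _ : Fin m => (Finset.univ : Finset X)) fun _ x => D x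
  rw [Fintype.piFinset_univ] at this
  rw [← this]
  simp [hD1]

/-- The expected energy after conditioning on `m` independent tuples. -/
noncomputable def meanEnergy {t k : ℕ} (Z : LocalPSDEnsemble V A t) (D : (Fin k → V) → ℝ)
    (m : ℕ) : ℝ :=
  ∑ s : Fin m → Fin k → V, (∏ j, D (s j)) * Z.prob.energy D (seed s)

variable {k L : ℕ} (Z : LocalPSDEnsemble V A (L + 2 * k)) {D : (Fin k → V) → ℝ}

theorem meanEnergy_succ_sub (hD1 : ∑ w, D w = 1) {m : ℕ} (hm : m * k ≤ L) :
    ∑ s : Fin m → Fin k → V, (∏ j, D (s j)) *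
      ∑ σ : seed s → A, Z.prob (seed s) σ * (Z.prob.cond (seed s) σ).meanChiSq D =
    Z.meanEnergy D (m + 1) - Z.meanEnergy D m := by
  have h1 : Z.meanEnergy D (m + 1) = ∑ s : Fin m → Fin k → V, (∏ j, D (s j)) *
      ∑ t, D t * Z.prob.energy D (seed s ∪ Finset.univ.image t) := by
    -- The seed walks are independent, so the additional one may be placed at index `0`.
    rw [meanEnergy, ← (Fin.consEquiv fun _ => Fin k → V).sum_comp, Fintype.sum_prod_type,
      Finset.sum_comm]
    refine Finset.sum_congr rfl fun s _ => ?_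
    rw [Finset.mul_sum]
    refine Finset.sum_congr rfl fun t _ => ?_
    simp only [Fin.consEquiv, Equiv.coe_fn_mk, Fin.prod_univ_succ, Fin.cons_zero, Fin.cons_succ,
      seed_cons]
    ring
  rw [h1, meanEnergy, ← Finset.sum_sub_distrib]
  refine Finset.sum_congr rfl fun s _ => ?_
  rw [Z.isConsistent.sum_mul_meanChiSq hD1 (by have := card_seed_le s; omega), mul_sub]

/-- The increments for `m = 1, …, ⌊L/k⌋` telescope to a difference of two expected energies, one at
most `1` and the other nonnegative. -/
theorem sliceExpectation_meanChiSq_le (hD : ∀ w, 0 ≤ D w) (hD1 : ∑ w, D w = 1) :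
    Z.sliceExpectation D L (fun Z' => Z'.meanChiSq D) ≤ 1 / ((L / k : ℕ) : ℝ) := by
  rw [sliceExpectation]
  refine div_le_div_of_nonneg_right ?_ (Nat.cast_nonneg _)
  have hmL : ∀ m ∈ Finset.Icc 1 (L / k), m * k ≤ L := fun m hm =>
    (Nat.mul_le_mul_right k (Finset.mem_Icc.1 hm).2).trans (Nat.div_mul_le_self L k)
  rw [Finset.sum_congr rfl fun m hm => Z.meanEnergy_succ_sub hD1 (hmL m hm)]
  rw [← Finset.Ico_add_one_right_eq_Icc, Finset.sum_Ico_sub _ (Nat.le_add_left 1 _)]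
  have hM := Nat.div_mul_le_self L k
  -- The last term has up to `L + k` seeds, and the energy looks at `k` further variables: together
  -- this fits the locality `L + 2 * k`.
  have hup : Z.meanEnergy D (L / k + 1) ≤ 1 := by
    rw [← sum_prod_eq_one hD1 (L / k + 1)]
    refine Finset.sum_le_sum fun s _ => mul_le_of_le_one_right
      (Finset.prod_nonneg fun j _ => hD _) (Z.isConsistent.energy_le_one hD hD1 ?_)
    have := card_seed_le s
    rw [add_mul] at this
    omega
  have hlow : 0 ≤ Z.meanEnergy D 1 ∨ L / k = 0 := by
    rcases Nat.eq_zero_or_pos (L / k) with h | h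
    · exact Or.inr h
    · left
      refine Finset.sum_nonneg fun s _ => mul_nonneg (Finset.prod_nonneg fun j _ => hD _)
        (Z.isConsistent.energy_nonneg hD ?_)
      have := card_seed_le s
      omega
  rcases hlow with h | h
  · linarith
  · simp [h]

/-- Reduces both tensoriality conditions to a pointwise estimate for a fixed conditioning: seeds
have at most `L` vertices, and null assignments carry no weight. -/
theorem sliceExpectation_le (hk : 1 ≤ k) (hkL : k ≤ L) (hD : ∀ w, 0 ≤ D w) (hD1 : ∑ w, D w = 1)
    {F : LocalFamily V A → ℝ} {a b : ℝ} (hb : 0 ≤ b)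
    (hF : ∀ (T : Finset V) (σ : T → A), T.card ≤ L → 0 < Z.prob T σ →
      F (Z.prob.cond T σ) ≤ a + b * (Z.prob.cond T σ).meanChiSq D) :
    Z.sliceExpectation D L F ≤ a + b * (1 / ((L / k : ℕ) : ℝ)) := by
  have hM : 0 < L / k := Nat.div_pos hkL hk
  have hM' : (0 : ℝ) < (L / k : ℕ) := Nat.cast_pos.2 hM
  refine le_trans ?_ (add_le_add_right (mul_le_mul_of_nonneg_left
    (Z.sliceExpectation_meanChiSq_le hD hD1) hb) a)
  have hconst : ∀ m ∈ Finset.Icc 1 (L / k), (∑ s : Fin m → Fin k → V, (∏ j, D (s j)) *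
      ∑ σ : seed s → A, Z.prob (seed s) σ * F (Z.prob.cond (seed s) σ)) ≤
      a + b * ∑ s : Fin m → Fin k → V, (∏ j, D (s j)) *
        ∑ σ : seed s → A, Z.prob (seed s) σ * (Z.prob.cond (seed s) σ).meanChiSq D := by
    intro m hm
    have hmL : m * k ≤ L :=
      (Nat.mul_le_mul_right k (Finset.mem_Icc.1 hm).2).trans (Nat.div_mul_le_self L k)
    have ha : a = ∑ s : Fin m → Fin k → V, (∏ j, D (s j)) * a := by
      rw [← Finset.sum_mul, sum_prod_eq_one hD1, one_mul]
    conv_rhs => rw [ha]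
    rw [Finset.mul_sum, ← Finset.sum_add_distrib]
    refine Finset.sum_le_sum fun s _ => ?_
    have hs := card_seed_le s
    have ha' : a = ∑ σ : seed s → A, Z.prob (seed s) σ * a := by
      rw [← Finset.sum_mul, Z.sum_eq_one _ (by omega), one_mul]
    rw [mul_left_comm b, ← mul_add]
    refine mul_le_mul_of_nonneg_left ?_ (Finset.prod_nonneg fun j _ => hD _)
    conv_rhs => rw [ha']
    rw [Finset.mul_sum, ← Finset.sum_add_distrib]
    refine Finset.sum_le_sum fun σ _ => ?_
    rw [mul_left_comm b, ← mul_add]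
    rcases (Z.nonneg (seed s) (by omega) σ).eq_or_lt with h | h
    · simp [← h]
    · exact mul_le_mul_of_nonneg_left (hF _ _ (by omega) h) h.le
  rw [sliceExpectation, sliceExpectation, div_le_iff₀ hM', add_mul, mul_assoc,
    div_mul_cancel₀ _ hM'.ne']
  refine (Finset.sum_le_sum hconst).trans_eq ?_
  rw [Finset.sum_add_distrib, ← Finset.mul_sum]
  simp [mul_comm]

end LocalPSDEnsemble

/-! ### Stationarity and marginals of random walks. -/

namespace WeightedGraph

variable {V : Type} [Fintype V] (G : WeightedGraph V)

theorem deg_pos (v : V) : 0 < G.deg v := by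
  obtain ⟨u, hu⟩ := G.exists_weight_pos v
  exact Finset.sum_pos' (fun u _ => G.weight_nonneg v u) ⟨u, Finset.mem_univ u, hu⟩

theorem sum_deg_pos [Nonempty V] : 0 < ∑ u, G.deg u :=
  Finset.sum_pos (fun u _ => G.deg_pos u) Finset.univ_nonempty

theorem step_nonneg (u v : V) : 0 ≤ G.step u v :=
  div_nonneg (G.weight_nonneg u v) (G.deg_pos u).le

theorem sum_step (u : V) : ∑ v, G.step u v = 1 := by
  simp only [step, ← Finset.sum_div]
  exact div_self (G.deg_pos u).ne'

theorem stationary_nonneg [Nonempty V] (v : V) : 0 ≤ G.stationary v :=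
  div_nonneg (G.deg_pos v).le G.sum_deg_pos.le

theorem sum_stationary [Nonempty V] : ∑ v, G.stationary v = 1 := by
  simp only [stationary, ← Finset.sum_div]
  exact div_self G.sum_deg_pos.ne'

theorem sum_stationary_mul_step (v : V) : ∑ u, G.stationary u * G.step u v = G.stationary v := by
  have : ∀ u, G.stationary u * G.step u v = G.weight v u / ∑ u, G.deg u := by
    intro u
    have := (G.deg_pos u).ne'
    rw [stationary, step, G.weight_symm]
    field_simp
  simp_rw [this, ← Finset.sum_div]
  rfl

theorem walkDist_nonneg [Nonempty V] : ∀ {k : ℕ} (w : Fin k → V), 0 ≤ G.walkDist k w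
  | 0, _ => zero_le_one
  | _ + 1, _ => mul_nonneg (G.stationary_nonneg _) (Finset.prod_nonneg fun _ _ => G.step_nonneg _ _)

theorem walkDist_snoc {k : ℕ} (s : Fin (k + 1) → V) (v : V) :
    G.walkDist (k + 2) (Fin.snoc s v : Fin (k + 2) → V) =
      G.walkDist (k + 1) s * G.step (s (Fin.last k)) v := by
  simp only [walkDist]
  rw [Fin.prod_univ_castSucc, ← mul_assoc]
  congr 1
  · congr 1
    refine Finset.prod_congr rfl fun i _ => ?_
    rw [Fin.snoc_castSucc, Fin.succ_castSucc, Fin.snoc_castSucc]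
  · rw [Fin.snoc_castSucc, Fin.succ_last, Fin.snoc_last]

theorem _root_.Fin.sum_univ_snoc {k : ℕ} (F : (Fin (k + 1) → V) → ℝ) :
    ∑ w, F w = ∑ s : Fin k → V, ∑ v, F (Fin.snoc s v : Fin (k + 1) → V) := by
  rw [← (Fin.snocEquiv fun _ => V).sum_comp, Fintype.sum_prod_type, Finset.sum_comm]
  rfl

theorem walkDist_one_snoc (s : Fin 0 → V) (v : V) :
    G.walkDist 1 (Fin.snoc s v : Fin 1 → V) = G.stationary v := by
  simp [walkDist, Fin.snoc]

/-- The first `k` vertices of a random walk on `k + 1` vertices form a random walk. -/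
theorem sum_walkDist_init [Nonempty V] (k : ℕ) (F : (Fin k → V) → ℝ) :
    ∑ w, G.walkDist (k + 1) w * F (Fin.init w) = ∑ s, G.walkDist k s * F s := by
  rw [Fin.sum_univ_snoc]
  refine Finset.sum_congr rfl fun s _ => ?_
  simp only [Fin.init_snoc, ← Finset.sum_mul]
  congr 1
  cases k with
  | zero => exact (Finset.sum_congr rfl fun v _ => G.walkDist_one_snoc s v).trans G.sum_stationary
  | succ k => simp only [walkDist_snoc, ← Finset.mul_sum, G.sum_step, mul_one]

theorem sum_walkDist [Nonempty V] (k : ℕ) : ∑ w, G.walkDist k w = 1 := by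
  induction k with
  | zero => simp [walkDist]
  | succ k ih => simpa [ih] using G.sum_walkDist_init k fun _ => 1

/-- The first `j` vertices of a random walk form a random walk. -/
theorem sum_walkDist_castLE [Nonempty V] {j k : ℕ} (h : j ≤ k) (F : (Fin j → V) → ℝ) :
    ∑ w, G.walkDist k w * F (w ∘ Fin.castLE h) = ∑ s, G.walkDist j s * F s := by
  induction k, h using Nat.le_induction with
  | base => rfl
  | succ k h ih => exact (G.sum_walkDist_init k fun s => F (s ∘ Fin.castLE h)).trans ih

/-- The last vertex of a random walk is stationary. -/
theorem sum_walkDist_last (k : ℕ) (F : V → ℝ) :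
    ∑ w, G.walkDist (k + 1) w * F (w (Fin.last k)) = ∑ v, G.stationary v * F v := by
  rw [Fin.sum_univ_snoc]
  induction k generalizing F with
  | zero =>
    rw [Fintype.sum_unique]
    refine Finset.sum_congr rfl fun v _ => ?_
    rw [walkDist_one_snoc, Fin.snoc_last]
  | succ k ih =>
    simp only [walkDist_snoc, Fin.snoc_last, mul_assoc, ← Finset.mul_sum]
    rw [Fin.sum_univ_snoc, ih fun u => ∑ v, G.step u v * F v]
    simp only [Finset.mul_sum]
    rw [Finset.sum_comm]
    refine Finset.sum_congr rfl fun v _ => ?_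
    simp only [← mul_assoc, ← Finset.sum_mul, G.sum_stationary_mul_step]

end WeightedGraph

/-! ### Spectral contraction and the mixing lemma. -/

/-- A symmetric operator fixing the unit vector `u`, all of whose eigenvalues but one are at most
`γ < 1` in absolute value, contracts the orthogonal complement of `u` by `γ`. -/
theorem OrthonormalBasis.norm_sub_inner_smul_sq_le {E ι : Type*} [NormedAddCommGroup E]
    [InnerProductSpace ℝ E] [Fintype ι] (b : OrthonormalBasis ι ℝ E) (T : E → E) (eig : ι → ℝ)
    (hT : ∀ i x, inner ℝ (b i) (T x) = eig i * inner ℝ (b i) x) {γ : ℝ} (hγ : γ < 1) (j : ι)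
    (heig : ∀ i, i ≠ j → |eig i| ≤ γ) {u : E} (hu : T u = u) (hu1 : ‖u‖ = 1) (x : E) :
    ‖T x - inner ℝ u x • u‖ ^ 2 ≤ γ ^ 2 * ‖x‖ ^ 2 := by
  -- A fixed vector has no component along an eigenvector with eigenvalue other than `1`. Hence `u =
  -- ± b j`, which also forces `eig j = 1`.
  have hoff : ∀ i, i ≠ j → inner ℝ (b i) u = 0 := by
    intro i hi
    have h1 := hT i u
    rw [hu] at h1
    have h2 : eig i < 1 := (le_abs_self _).trans_lt ((heig i hi).trans_lt hγ)
    have h3 : (1 - eig i) * inner ℝ (b i) u = 0 := by linarith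
    exact (mul_eq_zero.1 h3).resolve_left (by linarith)
  have hj : inner ℝ (b j) u ^ 2 = 1 := by
    have h := b.sum_sq_inner_right u
    rw [hu1, Finset.sum_eq_single j (fun i _ hi => by simp [hoff i hi]) (by simp)] at h
    simpa using h
  have hux : inner ℝ u x = inner ℝ (b j) u * inner ℝ (b j) x := by
    rw [← b.sum_inner_mul_inner u x, Finset.sum_eq_single j
      (fun i _ hi => by rw [real_inner_comm, hoff i hi, zero_mul]) (by simp), real_inner_comm]
  have heigj : eig j = 1 := by
    have h1 := hT j u
    rw [hu] at h1
    have h2 : inner ℝ (b j) u ≠ 0 := fun h => by simp [h] at hj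
    exact (mul_right_cancel₀ h2 (by rw [one_mul]; exact h1)).symm
  rw [← b.sum_sq_inner_right, ← b.sum_sq_inner_right x, Finset.mul_sum]
  refine Finset.sum_le_sum fun i _ => ?_
  rw [inner_sub_right, inner_smul_right, hT]
  rcases eq_or_ne i j with rfl | hi
  · rw [heigj, hux]
    have : 1 * inner ℝ (b i) x - inner ℝ (b i) u * inner ℝ (b i) x * inner ℝ (b i) u = 0 := by
      linear_combination (-inner ℝ (b i) x) * hj
    rw [this, zero_pow two_ne_zero]
    positivity
  · rw [hoff i hi, mul_zero, sub_zero, mul_pow]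
    exact mul_le_mul_of_nonneg_right (sq_le_sq.2 ((heig i hi).trans (le_abs_self _)))
      (sq_nonneg _)

namespace WeightedGraph

variable {V : Type} [Fintype V] [DecidableEq V] [Nonempty V] (G : WeightedGraph V)

theorem normAdj_mulVec (g : V → ℝ) (u : V) :
    (G.normAdj.mulVec fun v => √(G.stationary v) * g v) u =
      √(G.stationary u) * ∑ v, G.step u v * g v := by
  simp only [Matrix.mulVec, dotProduct, normAdj, Matrix.of_apply, Finset.mul_sum]
  refine Finset.sum_congr rfl fun v _ => ?_
  have hu := Real.sqrt_ne_zero'.2 (G.deg_pos u)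
  have hv := Real.sqrt_ne_zero'.2 (G.deg_pos v)
  have hD := Real.sqrt_ne_zero'.2 G.sum_deg_pos
  have hu2 := Real.sq_sqrt (G.deg_pos u).le
  rw [stationary, stationary, Real.sqrt_div (G.deg_pos v).le, Real.sqrt_div (G.deg_pos u).le, step]
  rw [show G.weight u v / G.deg u = G.weight u v / √(G.deg u) ^ 2 by rw [hu2]]
  field_simp

/-- Scaling by `√(stationary)` turns the weighted norm into the Euclidean one, the walk operator
into `normAdj`, and the constant function `1` into a fixed unit vector. -/
theorem IsTwoSidedExpander.sum_sq_le {γ : ℝ} (hG : G.IsTwoSidedExpander γ) (hγ : γ < 1)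
    (g : V → ℝ) :
    ∑ u, G.stationary u * (∑ v, G.step u v * g v - ∑ v, G.stationary v * g v) ^ 2 ≤
      γ ^ 2 * ∑ v, G.stationary v * g v ^ 2 := by
  have hsymm := Matrix.isSymmetric_toEuclideanLin_iff.mpr G.normAdj_isHermitian
  have hs : ∀ v, √(G.stationary v) * √(G.stationary v) = G.stationary v := fun v =>
    Real.mul_self_sqrt (G.stationary_nonneg v)
  let x : EuclideanSpace ℝ V := WithLp.toLp 2 fun v => √(G.stationary v) * g v
  let u : EuclideanSpace ℝ V := WithLp.toLp 2 fun v => √(G.stationary v)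
  have hTx : ∀ v, Matrix.toEuclideanLin G.normAdj x v =
      √(G.stationary v) * ∑ w, G.step v w * g w := G.normAdj_mulVec g
  have hTu : Matrix.toEuclideanLin G.normAdj u = u := by
    ext v
    have := G.normAdj_mulVec (fun _ => 1) v
    simp only [mul_one, G.sum_step] at this
    exact this
  have hu1 : ‖u‖ = 1 := by
    rw [← sq_eq_sq₀ (norm_nonneg _) zero_le_one, EuclideanSpace.real_norm_sq_eq, one_pow,
      ← G.sum_stationary]
    exact Finset.sum_congr rfl fun v _ => by rw [sq]; exact hs v
  have key := (hsymm.eigenvectorBasis finrank_euclideanSpace).norm_sub_inner_smul_sq_le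
    (Matrix.toEuclideanLin G.normAdj) G.normAdj_isHermitian.eigenvalues₀ (fun i y => by
      rw [← hsymm, hsymm.apply_eigenvectorBasis, inner_smul_left]
      rfl) hγ ⟨0, Fintype.card_pos⟩ (fun i hi => hG i (Nat.pos_of_ne_zero fun h => hi (Fin.ext h)))
    hTu hu1 x
  have hux : inner ℝ u x = ∑ v, G.stationary v * g v := by
    simp only [PiLp.inner_apply]
    refine Finset.sum_congr rfl fun v _ => ?_
    rw [← hs v]
    simp [u, x]
    ring
  rw [hux, EuclideanSpace.real_norm_sq_eq, EuclideanSpace.real_norm_sq_eq] at key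
  refine (Finset.sum_congr rfl fun v _ => ?_).trans_le
    (key.trans_eq (congrArg _ (Finset.sum_congr rfl fun v _ => ?_)))
  · have : (Matrix.toEuclideanLin G.normAdj x - (∑ v, G.stationary v * g v) • u) v =
        √(G.stationary v) * (∑ w, G.step v w * g w) -
          (∑ v, G.stationary v * g v) * √(G.stationary v) := by
      rw [← hTx]
      rfl
    rw [this]
    linear_combination (-(∑ w, G.step v w * g w - ∑ v, G.stationary v * g v) ^ 2) * hs v
  · change (√(G.stationary v) * g v) ^ 2 = _
    linear_combination (g v ^ 2) * hs v

/-- The mixing lemma for a walk and its last step. -/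
theorem IsTwoSidedExpander.sum_walkDist_mul_le {γ : ℝ} (hG : G.IsTwoSidedExpander γ) (hγ0 : 0 < γ)
    (hγ : γ < 1) {k : ℕ} (f : (Fin k → V) → ℝ) (g : V → ℝ) :
    ∑ w, G.walkDist (k + 1) w * (f (Fin.init w) * g (w (Fin.last k))) ≤
      (∑ s, G.walkDist k s * f s) * (∑ v, G.stationary v * g v) +
        γ / 2 * (∑ s, G.walkDist k s * f s ^ 2 + ∑ v, G.stationary v * g v ^ 2) := by
  rw [Fin.sum_univ_snoc]
  simp only [Fin.init_snoc, Fin.snoc_last]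
  -- With an empty prefix no step is taken: the vertex is stationary and the main term is exact.
  cases k with
  | zero =>
    have h : ∑ s : Fin 0 → V, ∑ v, G.walkDist (0 + 1) (Fin.snoc s v : Fin 1 → V) * (f s * g v) =
        (∑ s, G.walkDist 0 s * f s) * (∑ v, G.stationary v * g v) := by
      rw [Finset.sum_mul]
      refine Finset.sum_congr rfl fun s _ => ?_
      rw [Finset.mul_sum]
      refine Finset.sum_congr rfl fun v _ => ?_
      rw [show G.walkDist (0 + 1) (Fin.snoc s v : Fin 1 → V) = _ from G.walkDist_one_snoc s v]
      simp only [walkDist]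
      ring
    rw [h]
    have h1 : 0 ≤ ∑ s, G.walkDist 0 s * f s ^ 2 := Finset.sum_nonneg fun s _ =>
      mul_nonneg (G.walkDist_nonneg s) (sq_nonneg _)
    have h2 : 0 ≤ ∑ v, G.stationary v * g v ^ 2 := Finset.sum_nonneg fun s _ =>
      mul_nonneg (G.stationary_nonneg s) (sq_nonneg _)
    have : 0 ≤ γ / 2 * (∑ s, G.walkDist 0 s * f s ^ 2 + ∑ v, G.stationary v * g v ^ 2) := by
      positivity
    linarith
  | succ k =>
    set e := ∑ v, G.stationary v * g v with he
    have hspec := hG.sum_sq_le G hγ g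
    -- The end of the prefix is stationary, so the spectral bound becomes an average over prefixes.
    rw [← he, ← G.sum_walkDist_last k fun u => (∑ v, G.step u v * g v - e) ^ 2] at hspec
    have hpt : ∀ s : Fin (k + 1) → V,
        ∑ v, G.walkDist (k + 2) (Fin.snoc s v : Fin (k + 2) → V) * (f s * g v) ≤
        G.walkDist (k + 1) s * f s * e + γ / 2 * (G.walkDist (k + 1) s * f s ^ 2) +
        1 / (2 * γ) * (G.walkDist (k + 1) s *
          (∑ v, G.step (s (Fin.last k)) v * g v - e) ^ 2) := by
      intro s
      have h1 : ∑ v, G.walkDist (k + 2) (Fin.snoc s v : Fin (k + 2) → V) * (f s * g v) =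
          G.walkDist (k + 1) s * (f s * ∑ v, G.step (s (Fin.last k)) v * g v) := by
        rw [Finset.mul_sum, Finset.mul_sum]
        refine Finset.sum_congr rfl fun v _ => ?_
        rw [walkDist_snoc]
        ring
      rw [h1]
      set y := ∑ v, G.step (s (Fin.last k)) v * g v
      -- AM–GM weighted by `γ`: the factor `1 / (2γ)` meets the spectral `γ ^ 2`, so both error
      -- terms get `γ / 2`.
      have h2 : f s * (y - e) ≤ γ / 2 * f s ^ 2 + 1 / (2 * γ) * (y - e) ^ 2 := by
        have h3 : γ / 2 * f s ^ 2 + 1 / (2 * γ) * (y - e) ^ 2 - f s * (y - e) =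
            (γ * f s - (y - e)) ^ 2 / (2 * γ) := by
          field_simp
          ring
        have h4 : 0 ≤ (γ * f s - (y - e)) ^ 2 / (2 * γ) := by positivity
        linarith
      have h5 := mul_le_mul_of_nonneg_left h2 (G.walkDist_nonneg s)
      linarith
    refine (Finset.sum_le_sum fun s _ => hpt s).trans ?_
    rw [Finset.sum_add_distrib, Finset.sum_add_distrib, ← Finset.sum_mul, ← Finset.mul_sum,
      ← Finset.mul_sum]
    have h6 := mul_le_mul_of_nonneg_left hspec (by positivity : 0 ≤ 1 / (2 * γ))
    have h7 : 1 / (2 * γ) * (γ ^ 2 * ∑ v, G.stationary v * g v ^ 2) =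
        γ / 2 * ∑ v, G.stationary v * g v ^ 2 := by
      field_simp
    linarith

end WeightedGraph

/-! ### Comparison of the correlation measures, and decoupling along a step. -/

/-- This is `⟨x, y⟩² = ⟨x ⊗ x, y ⊗ y⟩`, summed over both families. It separates the dependence on
the two tuples. -/
theorem sum_sum_sq_sum_mul {α β N : Type*} [Fintype α] [Fintype β] [Fintype N] (x : α → N → ℝ)
    (y : β → N → ℝ) :
    ∑ a, ∑ b, (∑ i, x a i * y b i) ^ 2 =
      ∑ i, ∑ j, (∑ a, x a i * x a j) * ∑ b, y b i * y b j := by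
  simp_rw [sq, Finset.sum_mul_sum]
  calc _ = ∑ a, ∑ i, ∑ b, ∑ j, x a i * y b i * (x a j * y b j) :=
        Finset.sum_congr rfl fun a _ => Finset.sum_comm
    _ = ∑ i, ∑ a, ∑ b, ∑ j, x a i * y b i * (x a j * y b j) := Finset.sum_comm
    _ = ∑ i, ∑ a, ∑ j, ∑ b, x a i * y b i * (x a j * y b j) :=
        Finset.sum_congr rfl fun i _ => Finset.sum_congr rfl fun a _ => Finset.sum_comm
    _ = ∑ i, ∑ j, ∑ a, ∑ b, x a i * y b i * (x a j * y b j) :=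
        Finset.sum_congr rfl fun i _ => Finset.sum_comm
    _ = _ := by
      refine Finset.sum_congr rfl fun i _ => Finset.sum_congr rfl fun j _ =>
        Finset.sum_congr rfl fun a _ => Finset.sum_congr rfl fun b _ => by ring

namespace LocalFamily

variable {V A : Type} [Fintype V] [DecidableEq V] [Fintype A] [DecidableEq A]

/-- The `ℓ¹` distance of the joint distribution of two tuples from the product. -/
noncomputable def l1Cov (P : LocalFamily V A) {ι κ : Type} [Fintype ι] [DecidableEq ι] [Fintype κ]
    [DecidableEq κ] (f : ι → V) (g : κ → V) : ℝ :=
  ∑ a, ∑ b, |P.cov f g a b|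

/-- The squared `ℓ²` distance of the joint distribution of two tuples from the product. -/
noncomputable def l2Cov (P : LocalFamily V A) {ι κ : Type} [Fintype ι] [DecidableEq ι] [Fintype κ]
    [DecidableEq κ] (f : ι → V) (g : κ → V) : ℝ :=
  ∑ a, ∑ b, P.cov f g a b ^ 2

variable {P : LocalFamily V A} {n q : ℕ} {ι κ : Type} [Fintype ι] [DecidableEq ι] [Fintype κ]
  [DecidableEq κ]

theorem l1Cov_nonneg (f : ι → V) (g : κ → V) : 0 ≤ P.l1Cov f g :=
  Finset.sum_nonneg fun _ _ => Finset.sum_nonneg fun _ _ => abs_nonneg _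

theorem l2Cov_le_l1Cov_sq (f : ι → V) (g : κ → V) : P.l2Cov f g ≤ P.l1Cov f g ^ 2 := by
  simp only [l2Cov, l1Cov, ← Fintype.sum_prod_type']
  refine (Finset.sum_congr rfl fun x _ => (sq_abs _).symm).trans_le ?_
  exact Finset.sum_sq_le_sq_sum_of_nonneg fun _ _ => abs_nonneg _

/-- The assignments to a tuple with letters in the supports. -/
noncomputable def support (P : LocalFamily V A) (f : ι → V) : Finset (ι → A) :=
  Fintype.piFinset fun i => Finset.univ.filter fun a => P.single (f i) a ≠ 0

theorem card_support_le (hq : ∀ v, (Finset.univ.filter fun a => P.single v a ≠ 0).card ≤ q)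
    (f : ι → V) : (P.support f).card ≤ q ^ Fintype.card ι := by
  rw [support, Fintype.card_piFinset]
  exact (Finset.prod_le_pow_card _ _ _ fun i _ => hq (f i)).trans (by simp)

namespace IsConsistent

theorem cov_eq_zero_left (hP : P.IsConsistent n) {U : Finset V} (hU : U.card ≤ n) {f : ι → V}
    {g : κ → V} (hf : ∀ i, f i ∈ U) (hg : ∀ i, g i ∈ U) {a : ι → A} (b : κ → A)
    (h : P.tuple f a = 0) : P.cov f g a b = 0 := by
  have h1 := hP.tuple_elim_le_left hU hf hg a b
  have h2 := hP.tuple_nonneg hU (f := Sum.elim f g) (by rintro (i | i) <;> simp [hf, hg])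
    (Sum.elim a b)
  rw [cov, h, zero_mul, sub_zero]
  exact le_antisymm (h ▸ h1) h2

theorem cov_eq_zero_right (hP : P.IsConsistent n) {U : Finset V} (hU : U.card ≤ n) {f : ι → V}
    {g : κ → V} (hf : ∀ i, f i ∈ U) (hg : ∀ i, g i ∈ U) (a : ι → A) {b : κ → A}
    (h : P.tuple g b = 0) : P.cov f g a b = 0 := by
  have h1 := hP.tuple_elim_le_right hU hf hg a b
  have h2 := hP.tuple_nonneg hU (f := Sum.elim f g) (by rintro (i | i) <;> simp [hf, hg])
    (Sum.elim a b)
  rw [cov, h, mul_zero, sub_zero]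
  exact le_antisymm (h ▸ h1) h2

theorem tuple_eq_zero_of_notMem_support (hP : P.IsConsistent n) (hn : 1 ≤ n) {U : Finset V}
    (hU : U.card ≤ n) {f : ι → V} (hf : ∀ i, f i ∈ U) {a : ι → A} (ha : a ∉ P.support f) :
    P.tuple f a = 0 := by
  simp only [support, Fintype.mem_piFinset, Finset.mem_filter, Finset.mem_univ, true_and,
    not_forall, not_not] at ha
  obtain ⟨i, hi⟩ := ha
  exact hP.tuple_eq_zero_of_single hU hn hf hi

/-- Cauchy–Schwarz with weights `P.tuple g b`. Their total over the pairs is the size of the support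
of `f`, so the alphabet of `g` costs nothing. -/
theorem l1Cov_sq_le_chiSq (hP : P.IsConsistent n) (hn : 1 ≤ n)
    (hq : ∀ v, (Finset.univ.filter fun a => P.single v a ≠ 0).card ≤ q) {U : Finset V}
    (hU : U.card ≤ n) {f : ι → V} {g : κ → V} (hf : ∀ i, f i ∈ U) (hg : ∀ i, g i ∈ U) :
    P.l1Cov f g ^ 2 ≤ q ^ Fintype.card ι * P.chiSq f g := by
  have hpos : ∀ b, 0 ≤ P.tuple g b := hP.tuple_nonneg hU hg
  have h1 : P.l1Cov f g = ∑ x ∈ P.support f ×ˢ (Finset.univ : Finset (κ → A)),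
      |P.cov f g x.1 x.2| := by
    rw [Finset.sum_product, l1Cov]
    refine (Finset.sum_subset (Finset.subset_univ _) fun a _ ha => ?_).symm
    exact Finset.sum_eq_zero fun b _ => by
      rw [hP.cov_eq_zero_left hU hf hg b (hP.tuple_eq_zero_of_notMem_support hn hU hf ha), abs_zero]
  have h2 : ∑ x ∈ P.support f ×ˢ (Finset.univ : Finset (κ → A)),
      P.cov f g x.1 x.2 ^ 2 / P.tuple g x.2 ≤ P.chiSq f g := by
    rw [Finset.sum_product, chiSq]
    exact Finset.sum_le_sum_of_subset_of_nonneg (Finset.subset_univ _) fun a _ _ =>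
      Finset.sum_nonneg fun b _ => div_nonneg (sq_nonneg _) (hpos b)
  have h3 : ∑ x ∈ P.support f ×ˢ (Finset.univ : Finset (κ → A)), P.tuple g x.2 ≤
      (q : ℝ) ^ Fintype.card ι := by
    rw [Finset.sum_product]
    simp only [hP.sum_tuple hU hg, Finset.sum_const, nsmul_eq_mul, mul_one]
    exact_mod_cast card_support_le hq f
  have h4 : ∀ x ∈ P.support f ×ˢ (Finset.univ : Finset (κ → A)), |P.cov f g x.1 x.2| ^ 2 ≤
      P.cov f g x.1 x.2 ^ 2 / P.tuple g x.2 * P.tuple g x.2 := by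
    intro x _
    rw [sq_abs]
    rcases eq_or_ne (P.tuple g x.2) 0 with h | h
    · rw [hP.cov_eq_zero_right hU hf hg x.1 h, h]
      simp
    · rw [div_mul_cancel₀ _ h]
  have h5 := Finset.sum_sq_le_sum_mul_sum_of_sq_le_mul _
    (fun x _ => div_nonneg (sq_nonneg _) (hpos _)) (fun x _ => hpos _) h4
  have h6 : 0 ≤ P.chiSq f g := Finset.sum_nonneg fun a _ => Finset.sum_nonneg fun b _ =>
    div_nonneg (sq_nonneg _) (hpos b)
  rw [h1, mul_comm]
  exact h5.trans (mul_le_mul h2 h3 (Finset.sum_nonneg fun x _ => hpos _) h6)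

/-- Unweighted Cauchy–Schwarz: only pairs of assignments within the supports contribute. -/
theorem l1Cov_sq_le_l2Cov (hP : P.IsConsistent n) (hn : 1 ≤ n)
    (hq : ∀ v, (Finset.univ.filter fun a => P.single v a ≠ 0).card ≤ q) {U : Finset V}
    (hU : U.card ≤ n) {f : ι → V} {g : κ → V} (hf : ∀ i, f i ∈ U) (hg : ∀ i, g i ∈ U) :
    P.l1Cov f g ^ 2 ≤ q ^ (Fintype.card ι + Fintype.card κ) * P.l2Cov f g := by
  have h1 : P.l1Cov f g = ∑ x ∈ P.support f ×ˢ P.support g, |P.cov f g x.1 x.2| := by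
    rw [Finset.sum_product, l1Cov]
    refine (Finset.sum_subset_zero_on_sdiff (Finset.subset_univ _) (fun a ha => ?_)
      (fun a _ => ?_)).symm
    · exact Finset.sum_eq_zero fun b _ => by
        rw [hP.cov_eq_zero_left hU hf hg b (hP.tuple_eq_zero_of_notMem_support hn hU hf
          (Finset.mem_sdiff.1 ha).2), abs_zero]
    · refine Finset.sum_subset (Finset.subset_univ _) fun b _ hb => ?_
      rw [hP.cov_eq_zero_right hU hf hg a (hP.tuple_eq_zero_of_notMem_support hn hU hg hb),
        abs_zero]
  have h2 : ∑ x ∈ P.support f ×ˢ P.support g, P.cov f g x.1 x.2 ^ 2 ≤ P.l2Cov f g := by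
    rw [l2Cov, ← Fintype.sum_prod_type' fun a b => P.cov f g a b ^ 2]
    exact Finset.sum_le_sum_of_subset_of_nonneg (Finset.subset_univ _) fun a _ _ => sq_nonneg _
  rw [h1]
  refine sq_sum_le_card_mul_sum_sq.trans ?_
  simp only [sq_abs]
  refine mul_le_mul ?_ h2 (Finset.sum_nonneg fun _ _ => sq_nonneg _) (by positivity)
  rw [Finset.card_product, pow_add]
  exact_mod_cast Nat.mul_le_mul (card_support_le hq f) (card_support_le hq g)

/-- A covariance of subtuples is the sum of the covariances over a fibre, so marginalizing contracts
the `ℓ¹` norm by the triangle inequality. -/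
theorem l1Cov_comp_le (hP : P.IsConsistent n) {U : Finset V} (hU : U.card ≤ n) {f : ι → V}
    {g : κ → V} (hf : ∀ i, f i ∈ U) (hg : ∀ i, g i ∈ U) {ι' κ' : Type} [Fintype ι']
    [DecidableEq ι'] [Fintype κ'] [DecidableEq κ'] (e : ι' → ι) (e' : κ' → κ) :
    P.l1Cov (f ∘ e) (g ∘ e') ≤ P.l1Cov f g := by
  have hfg : ∀ i, Sum.elim f g i ∈ U := by rintro (i | i) <;> simp [hf, hg]
  have key : ∀ (a' : ι' → A) (b' : κ' → A), P.cov (f ∘ e) (g ∘ e') a' b' =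
      ∑ a, ∑ b, if a ∘ e = a' then (if b ∘ e' = b' then P.cov f g a b else 0) else 0 := by
    intro a' b'
    have h1 := hP.sum_ite_tuple hU hfg (Sum.map e e') (Sum.elim a' b')
    rw [← (Equiv.sumArrowEquivProdArrow ι κ A).symm.sum_comp, Fintype.sum_prod_type,
      Sum.elim_comp_map] at h1
    rw [cov, ← h1, ← hP.sum_ite_tuple hU hf, ← hP.sum_ite_tuple hU hg, Finset.sum_mul_sum,
      ← Finset.sum_sub_distrib]
    refine Finset.sum_congr rfl fun a _ => ?_
    rw [← Finset.sum_sub_distrib]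
    refine Finset.sum_congr rfl fun b _ => ?_
    have h2 : ((Equiv.sumArrowEquivProdArrow ι κ A).symm (a, b) ∘ Sum.map e e' =
        Sum.elim a' b') ↔ a ∘ e = a' ∧ b ∘ e' = b' := by
      simp [funext_iff, Equiv.sumArrowEquivProdArrow]
    simp only [h2]
    by_cases ha : a ∘ e = a' <;> by_cases hb : b ∘ e' = b' <;> simp [ha, hb, cov]
    rfl
  calc P.l1Cov (f ∘ e) (g ∘ e')
      ≤ ∑ a', ∑ b', ∑ a, ∑ b,
          if a ∘ e = a' then (if b ∘ e' = b' then |P.cov f g a b| else 0) else 0 := by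
        refine Finset.sum_le_sum fun a' _ => Finset.sum_le_sum fun b' _ => ?_
        rw [key]
        refine (Finset.abs_sum_le_sum_abs _ _).trans (Finset.sum_le_sum fun a _ => ?_)
        refine (Finset.abs_sum_le_sum_abs _ _).trans (Finset.sum_le_sum fun b _ => ?_)
        split_ifs <;> simp
    _ = ∑ a', ∑ a, ∑ b, ∑ b',
          if a ∘ e = a' then (if b ∘ e' = b' then |P.cov f g a b| else 0) else 0 := by
        refine Finset.sum_congr rfl fun a' _ => ?_
        rw [Finset.sum_comm]
        exact Finset.sum_congr rfl fun a _ => Finset.sum_comm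
    _ = ∑ a', ∑ a, if a ∘ e = a' then ∑ b, |P.cov f g a b| else 0 := by
        refine Finset.sum_congr rfl fun a' _ => Finset.sum_congr rfl fun a _ => ?_
        split_ifs
        · exact Finset.sum_congr rfl fun b _ => by simp
        · simp
    _ = P.l1Cov f g := by
        rw [Finset.sum_comm]
        exact Finset.sum_congr rfl fun a _ => by simp

/-- Bounds the Frobenius norm of `∑ β_a β_aᵀ`. The joint probability and the product are nonnegative
with squares at most `p_a p_b`, hence so is the square of their difference, and these products sum
to `1`. -/
theorem l2Cov_self_le_one (hP : P.IsConsistent n) {U : Finset V} (hU : U.card ≤ n) {f : ι → V}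
    (hf : ∀ i, f i ∈ U) : P.l2Cov f f ≤ 1 := by
  have h1 := hP.sum_tuple hU hf
  have h0 := hP.tuple_nonneg hU hf
  have hle : ∀ a, P.tuple f a ≤ 1 := fun a => h1 ▸
    Finset.single_le_sum (fun a _ => h0 a) (Finset.mem_univ a)
  calc P.l2Cov f f ≤ ∑ a, ∑ b, P.tuple f a * P.tuple f b := by
        refine Finset.sum_le_sum fun a _ => Finset.sum_le_sum fun b _ => ?_
        rw [cov]
        have hx := hP.tuple_nonneg hU (f := Sum.elim f f) (by rintro (i | i) <;> simp [hf])
          (Sum.elim a b)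
        have hxa := hP.tuple_elim_le_left hU hf hf a b
        have hxb := hP.tuple_elim_le_right hU hf hf a b
        generalize P.tuple (Sum.elim f f) (Sum.elim a b) = x at *
        have hy0 := mul_nonneg (h0 a) (h0 b)
        have hy1 := mul_le_one₀ (hle a) (h0 b) (hle b)
        have hxx := mul_le_mul hxa hxb hx (h0 a)
        nlinarith [mul_nonneg hx hy0, mul_le_mul_of_nonneg_left hy1 hy0]
    _ = 1 := by rw [← Finset.sum_mul_sum, h1, one_mul]

/-- On an expander, the `ℓ²` correlation along a step of the walk is close to the average one. -/
theorem sum_walkDist_l2Cov_le [Nonempty V] {k : ℕ} (hP : P.IsConsistent (2 * k))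
    (hpsd : (P.covMatrix fun S => S.card ≤ k).PosSemidef) {G : WeightedGraph V} {γ : ℝ}
    (hG : G.IsTwoSidedExpander γ) (hγ0 : 0 < γ) (hγ : γ < 1) {j : ℕ} (hj : j + 1 ≤ k) :
    ∑ w, G.walkDist (j + 1) w * P.l2Cov (Fin.init w) (fun _ : Unit => w (Fin.last j)) ≤
      ∑ s, ∑ v, G.walkDist j s * G.stationary v * P.l2Cov s (fun _ : Unit => v) + γ := by
  obtain ⟨N, _, β, hβ⟩ := hP.exists_gram hpsd
  have hcj : Fintype.card (Fin j) ≤ k := by simp; omega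
  have hcu : Fintype.card Unit ≤ k := by simp; omega
  -- Entries of the matrix `∑ β_a β_aᵀ` of the prefix; `g` is the same for the new vertex.
  let f : N → N → (Fin j → V) → ℝ := fun i i' s =>
    ∑ a, eventVector β s a i * eventVector β s a i'
  let g : N → N → V → ℝ := fun i i' v =>
    ∑ b, eventVector β (fun _ : Unit => v) b i * eventVector β (fun _ : Unit => v) b i'
  have hfg : ∀ s v, P.l2Cov s (fun _ : Unit => v) = ∑ i, ∑ i', f i i' s * g i i' v := by
    intro s v
    simp only [l2Cov, hβ hcj hcu]
    exact sum_sum_sq_sum_mul _ _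
  have hU : ∀ {ι : Type} [Fintype ι] [DecidableEq ι] (f : ι → V), Fintype.card ι ≤ k →
      (Finset.univ.image f).card ≤ 2 * k := fun {ι} _ _ f h => by
    have := Finset.card_image_le (s := Finset.univ) (f := f)
    rw [Finset.card_univ] at this
    omega
  have hff : ∀ s, ∑ i, ∑ i', f i i' s ^ 2 ≤ 1 := by
    intro s
    refine le_trans (le_of_eq ?_) (hP.l2Cov_self_le_one (hU s hcj) (f := s) (by simp))
    simp only [l2Cov, hβ hcj hcj]
    refine Eq.trans ?_ (sum_sum_sq_sum_mul _ _).symm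
    exact Finset.sum_congr rfl fun i _ => Finset.sum_congr rfl fun i' _ => sq _
  have hgg : ∀ v, ∑ i, ∑ i', g i i' v ^ 2 ≤ 1 := by
    intro v
    refine le_trans (le_of_eq ?_) (hP.l2Cov_self_le_one (hU (fun _ : Unit => v) hcu)
      (f := fun _ : Unit => v) (by simp))
    simp only [l2Cov, hβ hcu hcu]
    refine Eq.trans ?_ (sum_sum_sq_sum_mul _ _).symm
    exact Finset.sum_congr rfl fun i _ => Finset.sum_congr rfl fun i' _ => sq _
  have swap : ∀ {X : Type} [Fintype X] (p : X → ℝ) (F : N → N → X → ℝ),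
      ∑ x, p x * ∑ i, ∑ i', F i i' x = ∑ i, ∑ i', ∑ x, p x * F i i' x := by
    intro X _ p F
    simp only [Finset.mul_sum]
    rw [Finset.sum_comm]
    exact Finset.sum_congr rfl fun i _ => Finset.sum_comm
  have avg : ∀ {X : Type} [Fintype X] (p : X → ℝ) (F : N → N → X → ℝ), (∀ x, 0 ≤ p x) →
      ∑ x, p x = 1 → (∀ x, ∑ i, ∑ i', F i i' x ≤ 1) →
      ∑ i, ∑ i', ∑ x, p x * F i i' x ≤ 1 := by
    intro X _ p F hp hp1 hF
    rw [← swap, ← hp1]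
    exact Finset.sum_le_sum fun x _ => mul_le_of_le_one_right (hp x) (hF x)
  have h1 := avg (G.walkDist j) (fun i i' s => f i i' s ^ 2) G.walkDist_nonneg (G.sum_walkDist j)
    hff
  have h2 := avg G.stationary (fun i i' v => g i i' v ^ 2) G.stationary_nonneg G.sum_stationary hgg
  simp only [hfg]
  rw [swap]
  have h3 : ∑ s, ∑ v, G.walkDist j s * G.stationary v * ∑ i, ∑ i', f i i' s * g i i' v =
      ∑ i, ∑ i', (∑ s, G.walkDist j s * f i i' s) * ∑ v, G.stationary v * g i i' v := by
    rw [← Fintype.sum_prod_type' fun s v =>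
      G.walkDist j s * G.stationary v * ∑ i, ∑ i', f i i' s * g i i' v,
      swap (fun x : (Fin j → V) × V => G.walkDist j x.1 * G.stationary x.2)
        fun i i' x => f i i' x.1 * g i i' x.2]
    refine Finset.sum_congr rfl fun i _ => Finset.sum_congr rfl fun i' _ => ?_
    rw [Finset.sum_mul_sum, Fintype.sum_prod_type]
    exact Finset.sum_congr rfl fun s _ => Finset.sum_congr rfl fun v _ => by ring
  rw [h3]
  -- Mixing in each entry. The averaged squared entries sum to at most `1` on each side, so the
  -- errors add up to at most `γ / 2 * (1 + 1)`, independently of the dimension.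
  refine (Finset.sum_le_sum fun i _ => Finset.sum_le_sum fun i' _ =>
    hG.sum_walkDist_mul_le G hγ0 hγ (f i i') (g i i')).trans ?_
  simp only [Finset.sum_add_distrib, ← Finset.mul_sum]
  nlinarith

end IsConsistent
end LocalFamily

/-! ### Averaged bounds for a fixed conditioning. -/

/-- Replaces Jensen's inequality: it bounds an average of `x` by that of `x ^ 2`, linearly, so that
the later average over slices passes through. The parameter `c` is the intended size of `x`. -/
theorem le_half_add_sq_div {x c : ℝ} (hc : 0 < c) : x ≤ c / 2 + 1 / (2 * c) * x ^ 2 := by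
  have h : c / 2 + 1 / (2 * c) * x ^ 2 - x = (x - c) ^ 2 / (2 * c) := by
    field_simp
    ring
  have : 0 ≤ (x - c) ^ 2 / (2 * c) := by positivity
  linarith

namespace LocalFamily

variable {V A : Type} [Fintype V] [DecidableEq V] [Fintype A] [DecidableEq A]
  {P : LocalFamily V A} {n q k : ℕ}

namespace IsConsistent

theorem sum_single (hP : P.IsConsistent n) (hn : 1 ≤ n) (v : V) : ∑ a, P.single v a = 1 := by
  have h := hP.sum_tuple (U := {v}) (by simpa using hn) (f := fun _ : Unit => v) (by simp)
  rw [← (Equiv.funUnique Unit A).symm.sum_comp] at h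
  rw [← h]
  exact Finset.sum_congr rfl fun a _ => (hP.tuple_const hn v a).symm

theorem single_nonneg (hP : P.IsConsistent n) (hn : 1 ≤ n) (v : V) (a : A) : 0 ≤ P.single v a :=
  hP.nonneg _ (by simpa using hn) _

theorem one_le_of_support [Nonempty V] (hP : P.IsConsistent n) (hn : 1 ≤ n)
    (hq : ∀ v, (Finset.univ.filter fun a => P.single v a ≠ 0).card ≤ q) : 1 ≤ q := by
  by_contra! h
  obtain ⟨v⟩ := ‹Nonempty V›
  have h1 := hq v
  rw [Nat.lt_one_iff.1 h, Nat.le_zero, Finset.card_eq_zero, Finset.filter_eq_empty_iff] at h1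
  have h2 := hP.sum_single hn v
  rw [Finset.sum_eq_zero fun a ha => not_not.1 (h1 ha)] at h2
  exact zero_ne_one h2

theorem card_image_union_le_two_mul {j l : ℕ} (hj : j ≤ k) (hl : l ≤ k) (s : Fin j → V)
    (t : Fin l → V) : (Finset.univ.image s ∪ Finset.univ.image t).card ≤ 2 * k :=
  card_image_union_le (by simpa using hj) (by simpa using hl) s t

theorem l1Cov_sq_le_chiSq_fin (hP : P.IsConsistent (2 * k)) (hk : 1 ≤ k)
    (hq : ∀ v, (Finset.univ.filter fun a => P.single v a ≠ 0).card ≤ q) (s t : Fin k → V) :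
    P.l1Cov s t ^ 2 ≤ q ^ k * P.chiSq s t := by
  simpa using hP.l1Cov_sq_le_chiSq (by omega) hq (card_image_union_le_two_mul le_rfl le_rfl s t)
    (f := s) (g := t) (fun i => by simp) (fun i => by simp)

theorem sum_sum_l1Cov_sq_le (hP : P.IsConsistent (2 * k)) (hk : 1 ≤ k)
    (hq : ∀ v, (Finset.univ.filter fun a => P.single v a ≠ 0).card ≤ q)
    {D : (Fin k → V) → ℝ} (hD : ∀ w, 0 ≤ D w) :
    ∑ s, ∑ t, D s * D t * P.l1Cov s t ^ 2 ≤ q ^ k * P.meanChiSq D := by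
  rw [meanChiSq, Finset.mul_sum]
  refine Finset.sum_le_sum fun s _ => ?_
  rw [Finset.mul_sum]
  refine Finset.sum_le_sum fun t _ => ?_
  rw [mul_left_comm]
  exact mul_le_mul_of_nonneg_left (hP.l1Cov_sq_le_chiSq_fin hk hq s t)
    (mul_nonneg (hD s) (hD t))

/-- The average correlation of two independent tuples. -/
theorem sum_sum_l1Cov_le (hP : P.IsConsistent (2 * k)) (hk : 1 ≤ k)
    (hq : ∀ v, (Finset.univ.filter fun a => P.single v a ≠ 0).card ≤ q)
    {D : (Fin k → V) → ℝ} (hD : ∀ w, 0 ≤ D w) (hD1 : ∑ w, D w = 1) {μ : ℝ} (hμ : 0 < μ) :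
    ∑ s, ∑ t, D s * D t * P.l1Cov s t ≤ μ / 2 + 1 / (2 * μ) * q ^ k * P.meanChiSq D := by
  calc ∑ s, ∑ t, D s * D t * P.l1Cov s t
      ≤ ∑ s, ∑ t, (D s * D t * (μ / 2) + 1 / (2 * μ) * (D s * D t * P.l1Cov s t ^ 2)) := by
        refine Finset.sum_le_sum fun s _ => Finset.sum_le_sum fun t _ => ?_
        have := mul_le_mul_of_nonneg_left (le_half_add_sq_div (x := P.l1Cov s t) hμ)
          (mul_nonneg (hD s) (hD t))
        linarith
    _ = μ / 2 + 1 / (2 * μ) * ∑ s, ∑ t, D s * D t * P.l1Cov s t ^ 2 := by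
        simp only [Finset.sum_add_distrib, ← Finset.mul_sum, ← Finset.sum_mul, hD1, one_mul,
          mul_one]
    _ ≤ _ := by
        rw [mul_assoc]
        exact add_le_add_right (mul_le_mul_of_nonneg_left (hP.sum_sum_l1Cov_sq_le hk hq hD)
          (by positivity)) _

/-- Splitting off the last entry of a tuple. -/
theorem sum_abs_tuple_sub_prod_le (hP : P.IsConsistent n) {j : ℕ} (hj : j + 1 ≤ n)
    (w : Fin (j + 1) → V) :
    ∑ a : Fin (j + 1) → A, |P.tuple w a - ∏ i, P.single (w i) (a i)| ≤
      P.l1Cov (Fin.init w) (fun _ : Unit => w (Fin.last j)) +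
        ∑ a : Fin j → A, |P.tuple (Fin.init w) a - ∏ i, P.single (Fin.init w i) (a i)| := by
  have hU : (Finset.univ.image w).card ≤ n := Finset.card_image_le.trans (by simpa using hj)
  have hw : ∀ i, w i ∈ Finset.univ.image w := fun i => by simp
  have hsplit : ∀ (a : Fin j → A) (x : A), P.tuple w (Fin.snoc a x : Fin (j + 1) → A) =
      P.tuple (Sum.elim (Fin.init w) fun _ : Unit => w (Fin.last j))
        (Sum.elim a fun _ : Unit => x) := by
    intro a x
    rw [← hP.tuple_comp_surjective hU hw
      (g := Sum.elim Fin.castSucc fun _ : Unit => Fin.last j) fun i => by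
        induction i using Fin.lastCases with
        | last => exact ⟨Sum.inr (), rfl⟩
        | cast i => exact ⟨Sum.inl i, rfl⟩]
    congr 1 <;> ext (i | i) <;> simp [Fin.init]
  have hl1 : P.l1Cov (Fin.init w) (fun _ : Unit => w (Fin.last j)) = ∑ a : Fin j → A, ∑ x : A,
      |P.tuple w (Fin.snoc a x : Fin (j + 1) → A) -
        P.tuple (Fin.init w) a * P.single (w (Fin.last j)) x| := by
    rw [l1Cov]
    refine Finset.sum_congr rfl fun a _ => ?_
    rw [← (Equiv.funUnique Unit A).symm.sum_comp]
    refine Finset.sum_congr rfl fun x _ => ?_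
    rw [hsplit, ← hP.tuple_const (ι := Unit) (by omega)]
    rfl
  -- The sum over the last letter of its own probability is `1`. This matches the triangle
  -- inequality through the hybrid in which only the last entry is made independent.
  have hlast : ∑ a : Fin j → A, |P.tuple (Fin.init w) a - ∏ i, P.single (Fin.init w i) (a i)| =
      ∑ a : Fin j → A, ∑ x : A, |P.tuple (Fin.init w) a - ∏ i, P.single (Fin.init w i) (a i)| *
        P.single (w (Fin.last j)) x := by
    refine Finset.sum_congr rfl fun a _ => ?_
    rw [← Finset.mul_sum, hP.sum_single (by omega), mul_one]
  rw [hl1, hlast, Fin.sum_univ_snoc, ← Finset.sum_add_distrib]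
  refine Finset.sum_le_sum fun a _ => ?_
  rw [← Finset.sum_add_distrib]
  refine Finset.sum_le_sum fun x _ => ?_
  rw [Fin.prod_univ_castSucc]
  simp only [Fin.snoc_castSucc, Fin.snoc_last]
  rw [← abs_of_nonneg (hP.single_nonneg (by omega : 1 ≤ n) (w (Fin.last j)) x), ← abs_mul,
    abs_of_nonneg (hP.single_nonneg (by omega : 1 ≤ n) (w (Fin.last j)) x)]
  refine le_trans (le_of_eq ?_) (abs_add_le _ _)
  congr 1
  simp only [Fin.init]
  ring

/-- The average correlation along one step of the walk. -/
theorem sum_walkDist_l1Cov_le [Nonempty V] (hP : P.IsConsistent (2 * k)) (hk : 1 ≤ k)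
    (hpsd : (P.covMatrix fun S => S.card ≤ k).PosSemidef)
    (hq : ∀ v, (Finset.univ.filter fun a => P.single v a ≠ 0).card ≤ q) {G : WeightedGraph V}
    {γ : ℝ} (hG : G.IsTwoSidedExpander γ) (hγ0 : 0 < γ) (hγ : γ < 1) {j : ℕ} (hj : j + 1 ≤ k)
    {c : ℝ} (hc : 0 < c) :
    ∑ w, G.walkDist (j + 1) w * P.l1Cov (Fin.init w) (fun _ : Unit => w (Fin.last j)) ≤
      c / 2 + 1 / (2 * c) * (q ^ k * (q ^ k * P.meanChiSq (G.walkDist k) + γ)) := by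
  have hq1 : 1 ≤ q := hP.one_le_of_support (by omega) hq
  have hindep : ∑ s, ∑ v, G.walkDist j s * G.stationary v * P.l2Cov s (fun _ : Unit => v) ≤
      q ^ k * P.meanChiSq (G.walkDist k) := by
    -- The prefix and the independent vertex are marginals of two independent full walks. The detour
    -- through `ℓ¹` is taken because that norm is monotone under marginals.
    refine le_trans ?_ (hP.sum_sum_l1Cov_sq_le hk hq G.walkDist_nonneg)
    obtain ⟨l, rfl⟩ : ∃ l, k = l + 1 := ⟨k - 1, by omega⟩
    calc ∑ s, ∑ v, G.walkDist j s * G.stationary v * P.l2Cov s (fun _ : Unit => v)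
        ≤ ∑ s, ∑ v, G.walkDist j s * G.stationary v * P.l1Cov s (fun _ : Unit => v) ^ 2 :=
          Finset.sum_le_sum fun s _ => Finset.sum_le_sum fun v _ =>
            mul_le_mul_of_nonneg_left (l2Cov_le_l1Cov_sq _ _)
              (mul_nonneg (G.walkDist_nonneg s) (G.stationary_nonneg v))
      _ = ∑ s, G.walkDist j s * ∑ v, G.stationary v * P.l1Cov s (fun _ : Unit => v) ^ 2 := by
          simp only [Finset.mul_sum, mul_assoc]
      _ = ∑ s, G.walkDist j s * ∑ t, G.walkDist (l + 1) t *
            P.l1Cov s (fun _ : Unit => t (Fin.last l)) ^ 2 := by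
          refine Finset.sum_congr rfl fun s _ => ?_
          rw [G.sum_walkDist_last l fun v => P.l1Cov s (fun _ : Unit => v) ^ 2]
      _ = ∑ s, G.walkDist (l + 1) s * ∑ t, G.walkDist (l + 1) t *
            P.l1Cov (s ∘ Fin.castLE (by omega : j ≤ l + 1))
              (fun _ : Unit => t (Fin.last l)) ^ 2 :=
          (G.sum_walkDist_castLE (by omega : j ≤ l + 1) fun s => ∑ t, G.walkDist (l + 1) t *
            P.l1Cov s (fun _ : Unit => t (Fin.last l)) ^ 2).symm
      _ ≤ ∑ s, ∑ t, G.walkDist (l + 1) s * G.walkDist (l + 1) t * P.l1Cov s t ^ 2 := by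
          refine Finset.sum_le_sum fun s _ => ?_
          rw [Finset.mul_sum]
          refine Finset.sum_le_sum fun t _ => ?_
          rw [← mul_assoc]
          refine mul_le_mul_of_nonneg_left (pow_le_pow_left₀ (l1Cov_nonneg _ _) ?_ 2)
            (mul_nonneg (G.walkDist_nonneg s) (G.walkDist_nonneg t))
          exact hP.l1Cov_comp_le (card_image_union_le_two_mul le_rfl le_rfl s t)
            (fun i => by simp) (fun i => by simp) _ (fun _ : Unit => Fin.last l)
  have hstep := (hP.sum_walkDist_l2Cov_le hpsd hG hγ0 hγ hj).trans (add_le_add_left hindep γ)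
  have hpt : ∀ w : Fin (j + 1) → V, P.l1Cov (Fin.init w) (fun _ : Unit => w (Fin.last j)) ≤
      c / 2 + 1 / (2 * c) *
        (q ^ k * P.l2Cov (Fin.init w) (fun _ : Unit => w (Fin.last j))) := by
    intro w
    refine (le_half_add_sq_div hc).trans (add_le_add_right
      (mul_le_mul_of_nonneg_left ?_ (by positivity)) _)
    have hU : (Finset.univ.image w).card ≤ 2 * k :=
      Finset.card_image_le.trans (by simp; omega)
    have h := hP.l1Cov_sq_le_l2Cov (by omega) hq hU (f := Fin.init w)
      (g := fun _ : Unit => w (Fin.last j)) (fun i => by simp [Fin.init]) (fun i => by simp)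
    refine h.trans (mul_le_mul_of_nonneg_right ?_ (Finset.sum_nonneg fun _ _ =>
      Finset.sum_nonneg fun _ _ => sq_nonneg _))
    refine pow_le_pow_right₀ (by exact_mod_cast hq1) ?_
    simpa using hj
  calc _ ≤ ∑ w, G.walkDist (j + 1) w * (c / 2 + 1 / (2 * c) *
        (q ^ k * P.l2Cov (Fin.init w) (fun _ : Unit => w (Fin.last j)))) :=
        Finset.sum_le_sum fun w _ => mul_le_mul_of_nonneg_left (hpt w) (G.walkDist_nonneg w)
    _ = c / 2 + 1 / (2 * c) * (q ^ k * ∑ w, G.walkDist (j + 1) w *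
          P.l2Cov (Fin.init w) (fun _ : Unit => w (Fin.last j))) := by
        simp only [mul_add, Finset.sum_add_distrib, ← Finset.sum_mul, G.sum_walkDist, one_mul,
          Finset.mul_sum]
        congr 1
        exact Finset.sum_congr rfl fun w _ => by ring
    _ ≤ _ := add_le_add_right (mul_le_mul_of_nonneg_left (mul_le_mul_of_nonneg_left hstep
        (by positivity)) (by positivity)) _

/-- The average distance of the distribution along a walk from the product distribution. -/
theorem sum_walkDist_abs_le [Nonempty V] (hP : P.IsConsistent (2 * k)) (hk : 1 ≤ k)
    (hpsd : (P.covMatrix fun S => S.card ≤ k).PosSemidef)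
    (hq : ∀ v, (Finset.univ.filter fun a => P.single v a ≠ 0).card ≤ q) {G : WeightedGraph V}
    {γ : ℝ} (hG : G.IsTwoSidedExpander γ) (hγ0 : 0 < γ) (hγ : γ < 1) {c : ℝ} (hc : 0 < c) :
    ∑ w, G.walkDist k w * ∑ a : Fin k → A, |P.tuple w a - ∏ i, P.single (w i) (a i)| ≤
      k * (c / 2 + 1 / (2 * c) * (q ^ k * (q ^ k * P.meanChiSq (G.walkDist k) + γ))) := by
  suffices h : ∀ j : ℕ, j ≤ k →
      ∑ w, G.walkDist j w * ∑ a : Fin j → A, |P.tuple w a - ∏ i, P.single (w i) (a i)| ≤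
        j * (c / 2 + 1 / (2 * c) * (q ^ k * (q ^ k * P.meanChiSq (G.walkDist k) + γ))) from
    h k le_rfl
  intro j
  induction j with
  | zero =>
    intro _
    have h : ∀ w : Fin 0 → V, ∑ a : Fin 0 → A, |P.tuple w a - ∏ i, P.single (w i) (a i)| = 0 := by
      intro w
      have := hP.sum_tuple (U := ∅) (by simp) (f := w) (fun i => i.elim0)
      rw [Fintype.sum_unique] at this ⊢
      rw [this]
      simp
    simp only [h, mul_zero, Finset.sum_const_zero, Nat.cast_zero, zero_mul, le_refl]
  | succ j ih =>
    intro hj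
    have h1 := ih (by omega)
    have h2 := hP.sum_walkDist_l1Cov_le hk hpsd hq hG hγ0 hγ hj hc
    rw [← G.sum_walkDist_init j] at h1
    refine (Finset.sum_le_sum fun w _ => mul_le_mul_of_nonneg_left
      (hP.sum_abs_tuple_sub_prod_le (by omega) w) (G.walkDist_nonneg w)).trans ?_
    simp only [mul_add (G.walkDist (j + 1) _), Finset.sum_add_distrib]
    push_cast
    linarith

end IsConsistent
end LocalFamily

/-! ### Conditioned ensembles and the choice of constants. -/

namespace LocalPSDEnsemble

variable {V A : Type} [Fintype V] [DecidableEq V] [Fintype A] [DecidableEq A] {L k q : ℕ}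
  (Z : LocalPSDEnsemble V A (L + 2 * k))

theorem cond_isConsistent {T : Finset V} {σ : T → A} (hT : T.card ≤ L) (hσ : 0 < Z.prob T σ) :
    (Z.prob.cond T σ).IsConsistent (2 * k) :=
  Z.isConsistent.cond_isConsistent (by omega) hσ

theorem cond_posSemidef (hk : 1 ≤ k) {T : Finset V} {σ : T → A} (hT : T.card ≤ L)
    (hσ : 0 < Z.prob T σ) : ((Z.prob.cond T σ).covMatrix fun S => S.card ≤ k).PosSemidef :=
  LocalFamily.covMatrix_posSemidef_mono (fun S hS => by omega)
    (Z.posSemidef T σ (by omega) hσ)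

theorem cond_support (hk : 1 ≤ k) (hq : Z.SupportLE q) {T : Finset V} {σ : T → A}
    (hT : T.card ≤ L) (hσ : 0 < Z.prob T σ) (v : V) :
    (Finset.univ.filter fun a => (Z.prob.cond T σ).single v a ≠ 0).card ≤ q := by
  refine (Finset.card_le_card fun a ha => ?_).trans (hq v)
  simp only [Finset.mem_filter, Finset.mem_univ, true_and] at ha ⊢
  contrapose! ha
  have hU : (insert v T).card ≤ L + 2 * k := (Finset.card_insert_le v T).trans (by omega)
  rw [← (Z.cond_isConsistent hT hσ).tuple_const (ι := Unit) (by omega),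
    Z.isConsistent.cond_tuple hU (Finset.subset_insert v T) (fun _ => by simp),
    Z.isConsistent.tuple_eq_zero_of_single hU (by omega) (i := Sum.inl ()) ?_ ha, zero_div]
  rintro (i | i)
  exacts [by simp, Finset.mem_insert_of_mem i.2]

end LocalPSDEnsemble

theorem mainTheorem9 :
    ∃ c' : ℝ, 0 < c' ∧ ∃ C' : ℝ, 0 < C' ∧
      ∀ (V A : Type) [Fintype V] [DecidableEq V] [Nonempty V] [Fintype A] [DecidableEq A]
        (G : WeightedGraph V) (k q L : ℕ) (μ γ : ℝ),
        1 ≤ k → 0 < μ → μ ≤ 1 →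
        c' * ((q : ℝ) ^ (4 * k) * (k : ℝ) ^ 7 / μ ^ 5) ≤ (L : ℝ) →
        G.IsTwoSidedExpander γ →
        γ ≤ C' * μ ^ 2 / ((k : ℝ) ^ 2 * (q : ℝ) ^ (2 * k)) →
        ∀ Z : LocalPSDEnsemble V A (L + 2 * k), Z.SupportLE q →
          Z.IsTwoStepTensorial (G.walkDist k) μ := by
  refine ⟨4, by norm_num, 1 / 2, by norm_num, ?_⟩
  intro V A _ _ _ _ _ G k q L μ γ hk hμ hμ1 hL hG hγ Z hZ
  have hq : 1 ≤ q := Z.isConsistent.one_le_of_support (by omega) hZ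
  have hk' : (1 : ℝ) ≤ k := by exact_mod_cast hk
  have hq' : (1 : ℝ) ≤ q := by exact_mod_cast hq
  have hQ : (1 : ℝ) ≤ (q : ℝ) ^ k := one_le_pow₀ hq'
  rw [show 4 * k = k * 4 by ring, pow_mul] at hL
  rw [show 2 * k = k * 2 by ring, pow_mul] at hγ
  obtain ⟨Q, hQdef⟩ : ∃ Q : ℝ, Q = (q : ℝ) ^ k := ⟨_, rfl⟩
  rw [← hQdef] at hL hγ hQ
  -- All that the estimates below need from the size of `L`.
  have hL3 : 4 * (Q ^ 2 * (k : ℝ) ^ 3 / μ ^ 2) ≤ L := by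
    refine le_trans ?_ hL
    refine mul_le_mul_of_nonneg_left (div_le_div₀ (by positivity) (mul_le_mul
      (pow_le_pow_right₀ hQ (by norm_num)) (pow_le_pow_right₀ hk' (by norm_num)) (by positivity)
      (by positivity)) (by positivity) (pow_le_pow_of_le_one hμ.le hμ1 (by norm_num)))
      (by norm_num)
  have hkL : k ≤ L := by
    have h1 : (k : ℝ) ≤ 4 * (Q ^ 2 * (k : ℝ) ^ 3 / μ ^ 2) := by
      have h2 : (1 : ℝ) ≤ 1 / μ ^ 2 := by
        rw [le_div_iff₀ (by positivity), one_mul]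
        exact pow_le_one₀ hμ.le hμ1
      have h3 : (k : ℝ) ≤ (k : ℝ) ^ 3 := le_self_pow₀ hk' (by norm_num)
      have h4 : (k : ℝ) ≤ Q ^ 2 * (k : ℝ) ^ 3 :=
        h3.trans (le_mul_of_one_le_left (by positivity) (one_le_pow₀ hQ))
      have h5 : (k : ℝ) ≤ Q ^ 2 * (k : ℝ) ^ 3 * (1 / μ ^ 2) :=
        h4.trans (le_mul_of_one_le_right (by positivity) h2)
      rw [mul_one_div] at h5
      linarith
    exact_mod_cast h1.trans hL3
  have hM : (1 : ℝ) / ((L / k : ℕ) : ℝ) ≤ μ ^ 2 / (2 * Q ^ 2 * k ^ 2) := by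
    have hM1 : 1 ≤ L / k := Nat.div_pos hkL hk
    -- Since `⌊L/k⌋ ≥ 1`, rounding down loses at most a factor `2`.
    have hM2 : (L : ℝ) ≤ 2 * ((L / k : ℕ) : ℝ) * k := by
      have h1 := Nat.div_add_mod L k
      have h2 := Nat.mod_lt L hk
      have h3 : L ≤ 2 * (L / k) * k := by nlinarith
      exact_mod_cast h3
    have hMpos : (0 : ℝ) < ((L / k : ℕ) : ℝ) := by exact_mod_cast hM1
    rw [div_le_div_iff₀ hMpos (by positivity)]
    have h1 := hL3.trans hM2
    rw [← mul_div_assoc, div_le_iff₀ (by positivity)] at h1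
    refine le_of_mul_le_mul_right (a := (2 * k : ℝ)) ?_ (by positivity)
    linarith
  -- The mixing lemma divides by the expansion parameter, while `γ` may be zero or negative (as on
  -- one vertex); its positive upper bound `δ` takes its place.
  obtain ⟨δ, hδdef⟩ : ∃ δ : ℝ, δ = 1 / 2 * μ ^ 2 / ((k : ℝ) ^ 2 * Q ^ 2) := ⟨_, rfl⟩
  rw [← hδdef] at hγ
  have hδ0 : 0 < δ := by rw [hδdef]; positivity
  have hδ1 : δ < 1 := by
    rw [hδdef, div_lt_one (by positivity)]
    have h1 : μ ^ 2 ≤ 1 := pow_le_one₀ hμ.le hμ1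
    have h2 : (1 : ℝ) ≤ (k : ℝ) ^ 2 * Q ^ 2 :=
      one_le_mul_of_one_le_of_one_le (one_le_pow₀ hk') (one_le_pow₀ hQ)
    linarith
  have hGδ : G.IsTwoSidedExpander δ := fun i hi => (hG i hi).trans hγ
  have hD := fun w => G.walkDist_nonneg (k := k) w
  have hD1 := G.sum_walkDist k
  refine ⟨⟨hkL, ?_⟩, ?_⟩
  -- With `c = μ / k` the `k` splittings cost `μ / 2` in total. The expansion error and the `chiSq`
  -- term then contribute at most `μ / 4` each.
  · refine (Z.sliceExpectation_le hk hkL hD hD1 (a := μ / 2 + k ^ 2 / (2 * μ) * (Q * δ))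
      (b := k ^ 2 / (2 * μ) * Q ^ 2) (by positivity) fun T σ hT hσ => ?_).trans ?_
    · refine ((Z.cond_isConsistent hT hσ).sum_walkDist_abs_le hk (Z.cond_posSemidef hk hT hσ)
        (Z.cond_support hk hZ hT hσ) hGδ hδ0 hδ1 (c := μ / k) (by positivity)).trans_eq ?_
      rw [← hQdef]
      field_simp
      ring
    · have h1 := mul_le_mul_of_nonneg_left hM
        (by positivity : 0 ≤ (k : ℝ) ^ 2 / (2 * μ) * Q ^ 2)
      have h2 : (k : ℝ) ^ 2 / (2 * μ) * Q ^ 2 * (μ ^ 2 / (2 * Q ^ 2 * k ^ 2)) = μ / 4 := by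
        field_simp
        norm_num
      have h3 : (k : ℝ) ^ 2 / (2 * μ) * (Q * δ) = μ / 4 / Q := by
        rw [hδdef]
        field_simp
        norm_num
      have h4 : μ / 4 / Q ≤ μ / 4 := div_le_self (by positivity) hQ
      linarith
  · refine (Z.sliceExpectation_le hk hkL hD hD1 (a := μ / 2) (b := 1 / (2 * μ) * Q)
      (by positivity) fun T σ hT hσ => ?_).trans ?_
    · rw [hQdef]
      exact (Z.cond_isConsistent hT hσ).sum_sum_l1Cov_le hk (Z.cond_support hk hZ hT hσ) hD hD1 hμ
    · have h1 := mul_le_mul_of_nonneg_left hM (by positivity : 0 ≤ 1 / (2 * μ) * Q)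
      have h2 : 1 / (2 * μ) * Q * (μ ^ 2 / (2 * Q ^ 2 * k ^ 2)) = μ / 4 / (Q * k ^ 2) := by
        field_simp
        norm_num
      have h3 : μ / 4 / (Q * k ^ 2) ≤ μ / 4 := div_le_self (by positivity)
        (one_le_mul_of_one_le_of_one_le hQ (one_le_pow₀ hk'))
      linarith
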